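/- **Theorem.** Let $d\in\mathbb N$, $I=[a,b]$ with $a\le b$, and let $\Gamma_I=C^0(I;\mathbb R^d)$ carry the uniform norm. For a separable metrizable space $X$, $\mathscr P(X)$ denotes the Borel probability measures on $X$ with the topology of narrow convergence (duality with bounded continuous functions on $X$). Write $e_t(\gamma)=\gamma(t)$, so that $(e_{t\sharp}\boldsymbol\eta)(\{y\})=\boldsymbol\eta(\{\gamma\in\Gamma_I:\gamma(t)=y\})\in[0,1]$ for $\boldsymbol\eta\in\mathscr P(\Gamma_I)$. A function $F:X\to[0,+\infty]$ on a topological space is called sequentially l.s.c. if $F(x)\le\liminf_n F(x_n)$ whenever $x_n\to x$. Let $f:I\times\mathscr P(\Gamma_I)\times\mathbb R^d\times\mathbb R^d\times[0,1]\to[0,+\infty]$, $(t,\boldsymbol\eta,y,z,s)\mapsto f(t,\boldsymbol\eta,y,z,s)$, be a Borel map such that - $f(t,\cdot,\cdot,\cdot,\cdot)$ is sequentially l.s.c. for a.e. $t\in I$; - $f(t,\boldsymbol\eta,y,\cdot,s)$ is convex for all $(t,\boldsymbol\eta,y,s)$; - $f(t,\boldsymbol\eta,y,z,\cdot)$ is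 non-increasing for all $(t,\boldsymbol\eta,y,z)$. Let $q\in[1,+\infty)$. Then: (i) the functional $K:\Gamma_I\times L^q(I;\mathbb R^d)\times\mathscr P(\Gamma_I)\to[0,+\infty]$, $$K(u,v,\boldsymbol\eta)=\int_I f\bigl(t,\boldsymbol\eta,u(t),v(t),(e_{t\sharp}\boldsymbol\eta)(\{u(t)\})\bigr)\,dt,$$ is sequentially l.s.c. with respect to the product of the uniform topology on $\Gamma_I$, the weak topology on $L^q(I;\mathbb R^d)$ and the narrow topology on $\mathscr P(\Gamma_I)$; (ii) let $W^{1,q}(I;\mathbb R^d)\subseteq\Gamma_I$ be the space of absolutely continuous curves $\gamma$ with $\dot\gamma\in L^q(I;\mathbb R^d)$, with the topology of the norm $\|\gamma\|_\infty+\|\dot\gamma\|_{L^q}$ (which, for $a<b$, is equivalent to the usual Sobolev norm $\|\gamma\|_{L^q}+\|\dot\gamma\|_{L^q}$). Regarding $\boldsymbol\eta\in\mathscr P(W^{1,q}(I;\mathbb R^d))$ also as an element of $\mathscr P(\Gamma_I)$ through the inclusion, the map $$\boldsymbol\eta\mapsto\int\int_I f\bigl(t,\boldsymbol\eta,\gamma(t),\dot\gamma(t),(e_{t\sharp}\boldsymbol\eta)(\{\gamma(t)\})\bigr)\,dt\,d\boldsymbol\eta(\gamma)$$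 is sequentially l.s.c. on $\mathscr P(W^{1,q}(I;\mathbb R^d))$ with its narrow topology. -/

import Mathlib

open MeasureTheory Set Filter Topology
open scoped ENNReal NNReal

/-- The Euclidean space `ℝ^d`. -/
abbrev Rd (d : ℕ) : Type := EuclideanSpace ℝ (Fin d)

/-- Lebesgue measure on the interval `I = [a, b]`. -/
noncomputable def lebesgue (a b : ℝ) : Measure (Icc a b) :=
  (volume : Measure ℝ).comap Subtype.val

instance lebesgue.instIsFiniteMeasure (a b : ℝ) : IsFiniteMeasure (lebesgue a b) := by
  refine ⟨?_⟩
  rw [lebesgue, (MeasurableEmbedding.subtype_coe measurableSet_Icc).comap_apply, image_univ, Subtype.range_coe]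
  exact measure_Icc_lt_top

/-- `Γ_I = C⁰(I; ℝ^d)` for `I = [a, b]`, with the uniform norm. -/
abbrev Curves (d : ℕ) (a b : ℝ) : Type := C(Icc a b, Rd d)

/-- `Γ_I` carries its Borel `σ`-algebra. -/
instance Curves.instMeasurableSpace (d : ℕ) (a b : ℝ) : MeasurableSpace (Curves d a b) :=
  borel _

instance Curves.instBorelSpace (d : ℕ) (a b : ℝ) : BorelSpace (Curves d a b) := ⟨rfl⟩

/-- `F : X → [0, ∞]` is sequentially lower semicontinuous. -/
def SeqLSC {X : Type*} [TopologicalSpace X] (F : X → ℝ≥0∞) : Prop :=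
  ∀ (x : ℕ → X) (x₀ : X), Tendsto x atTop (𝓝 x₀) → F x₀ ≤ liminf (fun n => F (x n)) atTop

/-- `F : X → [0, ∞]` is Borel with respect to the topology of `X`. -/
def IsBorelFun {X : Type*} [TopologicalSpace X] (F : X → ℝ≥0∞) : Prop :=
  Measurable[borel X] F

/-- The multiplicity `(e_t♯η)({y}) = η {γ | γ t = y}`, a number in `[0, 1]`. -/
noncomputable def mult {d : ℕ} {a b : ℝ} (η : ProbabilityMeasure (Curves d a b))
    (t : Icc a b) (y : Rd d) : unitInterval :=
  ⟨(η.map (f := fun γ : Curves d a b => γ t)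
      (ContinuousEvalConst.continuous_eval_const t).measurable.aemeasurable {y} : ℝ≥0),
    NNReal.coe_nonneg _, by exact_mod_cast ProbabilityMeasure.apply_le_one _ _⟩

/-- The classical derivative `γ̇(t)` relative to `I = [a, b]` (one-sided at the endpoints), with
value `0` where `γ` is not differentiable. -/
noncomputable def curveDeriv {d : ℕ} {a b : ℝ} (hab : a ≤ b) (γ : Curves d a b)
    (t : Icc a b) : Rd d :=
  derivWithin (IccExtend hab γ) (Icc a b) t

/-- The Sobolev space `W^{1,q}(I; ℝ^d)`, through continuous representatives: the absolutely
continuous curves whose (a.e. defined) derivative is in `L^q`. -/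
def W1q (d : ℕ) {a b : ℝ} (hab : a ≤ b) (q : ℝ≥0∞) : Type :=
  {γ : Curves d a b // AbsolutelyContinuousOnInterval (IccExtend hab γ) a b ∧
    MemLp (curveDeriv hab γ) q (lebesgue a b)}

namespace W1q

variable {d : ℕ} {a b : ℝ} {hab : a ≤ b} {q : ℝ≥0∞}

/-- The inclusion `W^{1,q}(I; ℝ^d) ⊆ Γ_I`. -/
def toCurve (γ : W1q d hab q) : Curves d a b := γ.1

/-- The derivative of a Sobolev curve, as an element of `L^q(I; ℝ^d)`. -/
noncomputable def derivLp (γ : W1q d hab q) : Lp (Rd d) q (lebesgue a b) :=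
  γ.2.2.toLp (curveDeriv hab γ.1)

/-- The topology of `W^{1,q}(I; ℝ^d)` given by the norm `‖γ‖_∞ + ‖γ̇‖_{L^q}`. For `a < b` this is
equivalent to the norm `‖γ‖_{L^q} + ‖γ̇‖_{L^q}`, see `topology_eq` below; for `a = b` one gets
`Γ_I` itself. -/
noncomputable instance instTopologicalSpace [Fact (1 ≤ q)] : TopologicalSpace (W1q d hab q) :=
  TopologicalSpace.induced (fun γ : W1q d hab q => (γ.toCurve, γ.derivLp)) inferInstance

noncomputable instance instMeasurableSpace [Fact (1 ≤ q)] : MeasurableSpace (W1q d hab q) := borel _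

instance instBorelSpace [Fact (1 ≤ q)] : BorelSpace (W1q d hab q) := ⟨rfl⟩

theorem continuous_toCurve [Fact (1 ≤ q)] : Continuous (toCurve : W1q d hab q → Curves d a b) := by
  have h : Continuous (fun γ : W1q d hab q => (γ.toCurve, γ.derivLp)) := continuous_induced_dom
  exact continuous_fst.comp h

/-- A probability measure on `W^{1,q}(I; ℝ^d)`, regarded as a probability measure on `Γ_I`. -/
noncomputable def pushCurves [Fact (1 ≤ q)] (η : ProbabilityMeasure (W1q d hab q)) :
    ProbabilityMeasure (Curves d a b) :=
  η.map (f := toCurve) continuous_toCurve.measurable.aemeasurable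

/-- Fundamental theorem of calculus for Sobolev curves. -/
theorem integral_curveDeriv (γ : W1q d hab q) (hq : 1 ≤ q) :
    IntervalIntegrable (derivWithin (IccExtend hab γ.toCurve) (Icc a b)) volume a b ∧
    ∀ t s : Icc a b, γ.toCurve t - γ.toCurve s =
      ∫ x in (s : ℝ)..t, derivWithin (IccExtend hab γ.toCurve) (Icc a b) x := by
  set F : ℝ → Rd d := IccExtend hab γ.toCurve with hF
  set w : ℝ → Rd d := derivWithin F (Icc a b) with hw
  have hAC : AbsolutelyContinuousOnInterval F a b := γ.2.1
  have hint : Integrable (fun t : Icc a b => w t) (lebesgue a b) := γ.2.2.integrable hq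
  have hon : IntegrableOn w (Icc a b) volume := by
    rw [IntegrableOn, ← map_comap_subtype_coe measurableSet_Icc,
      (MeasurableEmbedding.subtype_coe measurableSet_Icc).integrable_map_iff]
    exact hint
  have hii : IntervalIntegrable w volume a b := by
    rw [intervalIntegrable_iff_integrableOn_Icc_of_le hab]; exact hon
  refine ⟨hii, ?_⟩
  have hGr := hii.norm.absolutelyContinuousOnInterval_intervalIntegral (c := a) (by simp)
  have hsub : ∀ x ∈ uIcc a b, ∀ y ∈ uIcc a b, IntervalIntegrable w volume x y := fun x hx y hy =>
    hii.mono_set (uIcc_subset_uIcc hx hy)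
  have hG : AbsolutelyContinuousOnInterval (fun x => ∫ v in a..x, w v) a b := by
    rw [absolutelyContinuousOnInterval_iff] at hGr ⊢
    intro ε hε
    obtain ⟨δ, hδ, h⟩ := hGr ε hε
    refine ⟨δ, hδ, fun E hE hl => lt_of_le_of_lt (Finset.sum_le_sum fun i hi => ?_) (h E hE hl)⟩
    obtain ⟨h1, h2⟩ := hE.1 i hi
    have ha : a ∈ uIcc a b := by simp
    rw [dist_eq_norm, dist_eq_norm,
      intervalIntegral.integral_interval_sub_left (hsub _ ha _ h1) (hsub _ ha _ h2),
      intervalIntegral.integral_interval_sub_left (hsub _ ha _ h1).norm (hsub _ ha _ h2).norm]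
    exact intervalIntegral.norm_integral_le_abs_integral_norm
  have hd : ∀ᵐ x, x ∈ uIcc a b → HasDerivAt (F - fun x => ∫ v in a..x, w v) 0 x := by
    have ha' : ∀ᵐ x : ℝ, x ≠ a := by simp [ae_iff]
    have hb' : ∀ᵐ x : ℝ, x ≠ b := by simp [ae_iff]
    filter_upwards [hAC.boundedVariationOn.ae_differentiableAt_of_mem_uIcc,
      hii.ae_hasDerivAt_integral, ha', hb'] with x h1 h2 h3 h4 hx
    have hx' := hx
    rw [uIcc_of_le hab] at hx'
    have hn : Icc a b ∈ 𝓝 x :=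
      Icc_mem_nhds (lt_of_le_of_ne hx'.1 h3.symm) (lt_of_le_of_ne hx'.2 h4)
    have e : w x = deriv F x := derivWithin_of_mem_nhds hn
    have := (h1 hx).hasDerivAt.sub (h2 hx a (by simp))
    rwa [e, sub_self] at this
  obtain ⟨C, hC⟩ := (hAC.sub hG).const_of_ae_hasDerivAt_zero hd
  intro t s
  have ht : (t : ℝ) ∈ uIcc a b := by rw [uIcc_of_le hab]; exact t.2
  have hs : (s : ℝ) ∈ uIcc a b := by rw [uIcc_of_le hab]; exact s.2
  have e1 := hC t ht
  have e2 := hC s hs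
  have ha : a ∈ uIcc a b := by simp
  rw [← intervalIntegral.integral_interval_sub_left (hsub _ ha _ ht) (hsub _ ha _ hs)]
  simp only [Pi.sub_apply, hF, IccExtend_val] at e1 e2
  rw [sub_eq_iff_eq_add] at e1 e2
  rw [e1, e2]
  abel

theorem exists_integral_norm_le (hq : Fact (1 ≤ q)) : ∃ C : ℝ, 0 ≤ C ∧
    ∀ v : Lp (Rd d) q (lebesgue a b), ∫ t, ‖v t‖ ∂(lebesgue a b) ≤ C * ‖v‖ := by
  have hC : (lebesgue a b) univ ^ (1 / (1 : ℝ≥0∞).toReal - 1 / q.toReal) ≠ ∞ := by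
    refine ENNReal.rpow_ne_top_of_nonneg ?_ (measure_ne_top _ _)
    rcases eq_or_ne q ∞ with rfl | h
    · simp
    · have : 1 ≤ q.toReal := by
        simpa using (ENNReal.toReal_le_toReal (by simp) h).2 hq.out
      simpa using inv_le_one_of_one_le₀ this
  refine ⟨_, ENNReal.toReal_nonneg (a := (lebesgue a b) univ ^
    (1 / (1 : ℝ≥0∞).toReal - 1 / q.toReal)), fun v => ?_⟩
  have h := eLpNorm_le_eLpNorm_mul_rpow_measure_univ hq.out (Lp.aestronglyMeasurable v)
  rw [integral_norm_eq_lintegral_enorm (Lp.aestronglyMeasurable v), ← eLpNorm_one_eq_lintegral_enorm,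
    Lp.norm_def, mul_comm, ← ENNReal.toReal_mul]
  exact ENNReal.toReal_mono (ENNReal.mul_ne_top (Lp.eLpNorm_ne_top v) hC) h

/-- The one-dimensional Sobolev inequality. -/
theorem exists_dist_le [hq : Fact (1 ≤ q)] (h : a < b) : ∃ C : ℝ, ∀ γ γ' : W1q d hab q,
    dist γ.toCurve γ'.toCurve ≤
      C * (‖ContinuousMap.toLp q (lebesgue a b) ℝ γ.toCurve -
        ContinuousMap.toLp q (lebesgue a b) ℝ γ'.toCurve‖ + ‖γ.derivLp - γ'.derivLp‖) := by
  obtain ⟨C, hC0, hC⟩ := exists_integral_norm_le (d := d) (a := a) (b := b) hq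
  have hba : 0 < b - a := sub_pos.2 h
  have hvol : (lebesgue a b).real univ = b - a := by
    rw [Measure.real, lebesgue,
      (MeasurableEmbedding.subtype_coe measurableSet_Icc).comap_apply, image_univ,
      Subtype.range_coe, Real.volume_Icc, ENNReal.toReal_ofReal hba.le]
  refine ⟨(b - a)⁻¹ * C + C, fun γ γ' => ?_⟩
  set A := ContinuousMap.toLp q (lebesgue a b) ℝ γ.toCurve -
        ContinuousMap.toLp q (lebesgue a b) ℝ γ'.toCurve with hA
  set B := γ.derivLp - γ'.derivLp with hB
  have hA' : ∫ s, ‖γ.toCurve s - γ'.toCurve s‖ ∂(lebesgue a b) ≤ C * ‖A‖ := by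
    refine le_trans (le_of_eq (integral_congr_ae ?_)) (hC A)
    filter_upwards [Lp.coeFn_sub (ContinuousMap.toLp q (lebesgue a b) ℝ γ.toCurve)
        (ContinuousMap.toLp q (lebesgue a b) ℝ γ'.toCurve),
      ContinuousMap.coeFn_toLp (p := q) (𝕜 := ℝ) (lebesgue a b) γ.toCurve,
      ContinuousMap.coeFn_toLp (p := q) (𝕜 := ℝ) (lebesgue a b) γ'.toCurve] with s h1 h2 h3
    rw [h1, Pi.sub_apply, h2, h3]
  have hB' : ∫ s, ‖curveDeriv hab γ.toCurve s - curveDeriv hab γ'.toCurve s‖ ∂(lebesgue a b)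
      ≤ C * ‖B‖ := by
    refine le_trans (le_of_eq (integral_congr_ae ?_)) (hC B)
    filter_upwards [Lp.coeFn_sub γ.derivLp γ'.derivLp,
      γ.2.2.coeFn_toLp, γ'.2.2.coeFn_toLp] with s h1 h2 h3
    rw [h1, Pi.sub_apply, derivLp, derivLp, h2, h3]
    rfl
  obtain ⟨i1, f1⟩ := γ.integral_curveDeriv hq.out
  obtain ⟨i2, f2⟩ := γ'.integral_curveDeriv hq.out
  have key : ∀ t s : Icc a b, ‖γ.toCurve t - γ'.toCurve t‖ ≤
      ‖γ.toCurve s - γ'.toCurve s‖ + C * ‖B‖ := by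
    intro t s
    have ht : (t : ℝ) ∈ uIcc a b := by rw [uIcc_of_le hab]; exact t.2
    have hs : (s : ℝ) ∈ uIcc a b := by rw [uIcc_of_le hab]; exact s.2
    have e : γ.toCurve t - γ'.toCurve t = (γ.toCurve s - γ'.toCurve s) +
        ∫ x in (s : ℝ)..t, (derivWithin (IccExtend hab γ.toCurve) (Icc a b) x -
          derivWithin (IccExtend hab γ'.toCurve) (Icc a b) x) := by
      rw [intervalIntegral.integral_sub (i1.mono_set (uIcc_subset_uIcc hs ht))
        (i2.mono_set (uIcc_subset_uIcc hs ht)), ← f1, ← f2]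
      abel
    rw [e]
    refine (norm_add_le _ _).trans (add_le_add le_rfl (le_trans ?_ hB'))
    refine intervalIntegral.norm_integral_le_integral_norm_uIoc.trans ?_
    have hi : IntegrableOn (fun x => ‖derivWithin (IccExtend hab γ.toCurve) (Icc a b) x -
          derivWithin (IccExtend hab γ'.toCurve) (Icc a b) x‖) (Icc a b) volume :=
      (intervalIntegrable_iff_integrableOn_Icc_of_le hab).1 (i1.sub i2).norm
    have hsub : uIoc (s : ℝ) t ⊆ Icc a b :=
      (uIoc_subset_uIcc.trans (uIcc_subset_uIcc hs ht)).trans (uIcc_of_le hab).subset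
    refine (setIntegral_mono_set hi (Eventually.of_forall fun _ => norm_nonneg _)
      hsub.eventuallyLE).trans (le_of_eq ?_)
    exact (integral_subtype_comap measurableSet_Icc (fun x =>
      ‖derivWithin (IccExtend hab γ.toCurve) (Icc a b) x -
          derivWithin (IccExtend hab γ'.toCurve) (Icc a b) x‖)).symm
  have hA0 : 0 ≤ ‖A‖ := norm_nonneg _
  have hB0 : 0 ≤ ‖B‖ := norm_nonneg _
  refine (ContinuousMap.dist_le (by positivity)).2 fun t => ?_
  rw [dist_eq_norm]
  have hc : Integrable (fun s => ‖γ.toCurve s - γ'.toCurve s‖) (lebesgue a b) :=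
    (BoundedContinuousFunction.mkOfCompact (γ.toCurve - γ'.toCurve)).integrable _ |>.norm
  have hm : ∫ _s : Icc a b, ‖γ.toCurve t - γ'.toCurve t‖ ∂(lebesgue a b) ≤
      ∫ s, (‖γ.toCurve s - γ'.toCurve s‖ + C * ‖B‖) ∂(lebesgue a b) :=
    integral_mono (integrable_const _) (hc.add (integrable_const _)) (key t)
  rw [integral_add hc (integrable_const _), integral_const, integral_const, hvol, smul_eq_mul,
    smul_eq_mul] at hm
  have hm' : (b - a) * ‖γ.toCurve t - γ'.toCurve t‖ ≤ C * ‖A‖ + (b - a) * (C * ‖B‖) := by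
    linarith
  have : ‖γ.toCurve t - γ'.toCurve t‖ ≤ (b - a)⁻¹ * (C * ‖A‖) + C * ‖B‖ := by
    have := mul_le_mul_of_nonneg_left hm' (inv_nonneg.2 hba.le)
    rwa [inv_mul_cancel_left₀ hba.ne', mul_add, inv_mul_cancel_left₀ hba.ne'] at this
  have p1 : 0 ≤ (b - a)⁻¹ * (C * ‖B‖) := by positivity
  have p2 : 0 ≤ C * ‖A‖ := by positivity
  linarith

/-- For `a < b` the topology is the one of the norm `‖γ‖_{L^q} + ‖γ̇‖_{L^q}`. -/
theorem topology_eq [Fact (1 ≤ q)] (h : a < b) :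
    (instTopologicalSpace : TopologicalSpace (W1q d hab q)) =
      TopologicalSpace.induced (fun γ : W1q d hab q =>
        (ContinuousMap.toLp q (lebesgue a b) ℝ γ.toCurve, γ.derivLp)) inferInstance := by
  refine le_antisymm ?_ ?_
  · rw [← continuous_iff_le_induced]
    have h0 : Continuous (fun γ : W1q d hab q => (γ.toCurve, γ.derivLp)) := continuous_induced_dom
    exact ((ContinuousMap.toLp q (lebesgue a b) ℝ).continuous.comp (continuous_fst.comp h0)).prodMk
      (continuous_snd.comp h0)
  · refine continuous_iff_le_induced.1 ?_
    let _ : TopologicalSpace (W1q d hab q) := TopologicalSpace.induced (fun γ : W1q d hab q =>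
        (ContinuousMap.toLp q (lebesgue a b) ℝ γ.toCurve, γ.derivLp)) inferInstance
    have h0 : Continuous (fun γ : W1q d hab q =>
        (ContinuousMap.toLp q (lebesgue a b) ℝ γ.toCurve, γ.derivLp)) := continuous_induced_dom
    have h1 := continuous_fst.comp h0
    have h2 := continuous_snd.comp h0
    refine Continuous.prodMk ?_ h2
    obtain ⟨C, hC⟩ := exists_dist_le (d := d) (hab := hab) (q := q) h
    refine continuous_iff_continuousAt.2 fun γ => tendsto_iff_dist_tendsto_zero.2 ?_
    refine squeeze_zero (fun _ => dist_nonneg) (fun γ' => hC γ' γ) ?_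
    have h3 := ((h1.sub (continuous_const (y :=
      ContinuousMap.toLp q (lebesgue a b) ℝ γ.toCurve))).norm.add
      (h2.sub (continuous_const (y := γ.derivLp))).norm).const_mul C
    simpa using h3.tendsto γ

end W1q

/-- `K(u, v, η) = ∫_I f(t, η, u(t), v(t), (e_t♯η)({u(t)})) dt`. -/
noncomputable def functionalK {d : ℕ} {a b : ℝ} {q : ℝ≥0∞}
    (f : Icc a b → ProbabilityMeasure (Curves d a b) → Rd d → Rd d → unitInterval → ℝ≥0∞)
    (u : Curves d a b) (v : Lp (Rd d) q (lebesgue a b))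
    (η : ProbabilityMeasure (Curves d a b)) : ℝ≥0∞ :=
  ∫⁻ t, f t η (u t) (v t) (mult η t (u t)) ∂(lebesgue a b)

/-- `η ↦ ∫∫_I f(t, η, γ(t), γ̇(t), (e_t♯η)({γ(t)})) dt dη(γ)` for `η ∈ P(W^{1,q}(I; ℝ^d))`. -/
noncomputable def functionalJ {d : ℕ} {a b : ℝ} {hab : a ≤ b} {q : ℝ≥0∞} [Fact (1 ≤ q)]
    (f : Icc a b → ProbabilityMeasure (Curves d a b) → Rd d → Rd d → unitInterval → ℝ≥0∞)
    (η : ProbabilityMeasure (W1q d hab q)) : ℝ≥0∞ :=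
  ∫⁻ γ : W1q d hab q, ∫⁻ t : Icc a b,
    f t (W1q.pushCurves η) (γ.toCurve t) (curveDeriv hab γ.toCurve t)
      (mult (W1q.pushCurves η) t (γ.toCurve t)) ∂(lebesgue a b) ∂(η : Measure (W1q d hab q))

/-! For (i), absorb `u n` and `η n` into the integrand, writing g_n(t, z) for f(t, η_n, u_n(t), z,
m_n(t)) with m_n(t) the multiplicity. Portmanteau on small closed balls makes the multiplicity upper
semicontinuous in (η, y), and f is non-increasing in it, so g(t, z) ≤ liminf g_n(t, z_n) whenever
z_n → z (`integrand_le_liminf`).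

There remains Ioffe's theorem for weakly convergent v_n (`lintegral_le_of_tendsto_weak`). Mazur's
lemma gives convex combinations converging a.e., but v_n(t) may be unbounded in n, and far out an
affine minorant of g(t, ·) need not lie below g_n(t, ·). Weak convergence forces uniform
integrability (Baire), hence a superlinear Φ with ∫ Φ(|v_n|) ≤ 2. A slightly lowered affine minorant
of g lies below g_n + εΦ for all large n: by compactness on a ball, by superlinearity outside.
Affine maps commute with convex combinations; Fatou and ε → 0 conclude.

For (ii), the functional is ∫ K(γ, γ̇, η) dη(γ). Part (i) bounds K from below along γ_j → γ and
η_{n_j} → η, and a portmanteau theorem with varying integrands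
(`lintegral_le_liminf_lintegral_of_le_liminf`) integrates this bound. -/

/-! ### Uniform integrability: Vitali–Hahn–Saks and de la Vallée-Poussin. -/

section UniformIntegrability

variable {α : Type*} [MeasurableSpace α] {μ : Measure α}

/-- Absolute continuity of integrals over sets controls the integrals of absolute values. -/
theorem eLpNorm_one_indicator_le_of_abs_setIntegral_le {g : α → ℝ} (hg : Integrable g μ)
    (hgm : Measurable g) {A : Set α} (hA : MeasurableSet A) {ε : ℝ}
    (h : ∀ B ⊆ A, MeasurableSet B → |∫ x in B, g x ∂μ| ≤ ε) :
    eLpNorm (A.indicator g) 1 μ ≤ ENNReal.ofReal (2 * ε) := by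
  rw [eLpNorm_indicator_eq_eLpNorm_restrict hA, eLpNorm_one_eq_lintegral_enorm,
    ← ofReal_integral_norm_eq_lintegral_enorm hg.integrableOn]
  refine ENNReal.ofReal_le_ofReal ?_
  -- On each of the two sign parts of `A` the integral of |g| is the absolute value of an integral
  -- of g, so each costs at most `ε`.
  set P : Set α := {x | 0 ≤ g x} with hP
  have hPm : MeasurableSet P := measurableSet_le measurable_const hgm
  have hsplit := integral_inter_add_sdiff (μ := μ) (f := fun x => ‖g x‖) (s := A) hPm
    hg.norm.integrableOn
  rw [sdiff_eq] at hsplit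
  rw [← hsplit]
  have h1 : ∫ x in A ∩ P, ‖g x‖ ∂μ = ∫ x in A ∩ P, g x ∂μ :=
    setIntegral_congr_fun (hA.inter hPm) fun x hx => Real.norm_of_nonneg hx.2
  have h2 : ∫ x in A ∩ Pᶜ, ‖g x‖ ∂μ = - ∫ x in A ∩ Pᶜ, g x ∂μ := by
    rw [← integral_neg]
    refine setIntegral_congr_fun (hA.inter hPm.compl) fun x hx => Real.norm_of_nonpos ?_
    exact (not_le.1 (show ¬ (0 ≤ g x) from hx.2)).le
  rw [h1, h2]
  have e1 := (abs_le.1 (h (A ∩ P) inter_subset_left (hA.inter hPm))).2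
  have e2 := (abs_le.1 (h (A ∩ Pᶜ) inter_subset_left (hA.inter hPm.compl))).1
  linarith

/-- A sequence of integrable functions whose integrals against all `[0, 1]`-valued weights
are Cauchy is uniformly integrable (Vitali–Hahn–Saks). -/
theorem unifIntegrable_of_cauchySeq_integral_mul [IsFiniteMeasure μ] {g : ℕ → α → ℝ}
    (hgm : ∀ n, Measurable (g n)) (hg : ∀ n, Integrable (g n) μ)
    (H : ∀ φ : α → ℝ, AEStronglyMeasurable φ μ → (∀ᵐ x ∂μ, φ x ∈ Icc (0 : ℝ) 1) →
      CauchySeq fun n => ∫ x, φ x * g n x ∂μ) :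
    UnifIntegrable g 1 μ := by
  classical
  intro ε hε
  -- Integrals over small sets will be at most `3 * ε'`; the sign splitting doubles this.
  set ε' := ε / 6 with hε'
  have hε'0 : 0 < ε' := by positivity
  -- Baire's theorem is applied to the [0, 1]-valued weights with the L¹ distance, for which
  -- changing a weight on `A` moves it by at most μ(A).
  let X : Type _ := Icc (0 : Lp ℝ 1 μ) (Lp.const 1 μ (1 : ℝ))
  have : CompleteSpace X := isClosed_Icc.completeSpace_coe
  have hX : ∀ φ : Lp ℝ 1 μ, φ ∈ Icc (0 : Lp ℝ 1 μ) (Lp.const 1 μ (1 : ℝ)) ↔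
      ∀ᵐ x ∂μ, φ x ∈ Icc (0 : ℝ) 1 := by
    intro φ
    rw [mem_Icc, ← Lp.coeFn_nonneg, ← Lp.coeFn_le]
    constructor
    · rintro ⟨h1, h2⟩
      filter_upwards [h1, h2, Lp.coeFn_const (p := 1) (μ := μ) (1 : ℝ)] with x a b c
      rw [c] at b
      exact ⟨a, b⟩
    · intro h
      constructor
      · filter_upwards [h] with x a using a.1
      · filter_upwards [h, Lp.coeFn_const (p := 1) (μ := μ) (1 : ℝ)] with x a c
        rw [c]; exact a.2
  have hint : ∀ (φ : α → ℝ), AEStronglyMeasurable φ μ → (∀ᵐ x ∂μ, φ x ∈ Icc (0 : ℝ) 1) →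
      ∀ n, Integrable (fun x => φ x * g n x) μ := by
    intro φ hφ h n
    refine (hg n).bdd_mul (c := 1) hφ ?_
    filter_upwards [h] with x hx
    rw [Real.norm_of_nonneg hx.1]; exact hx.2
  let F : ℕ → Set X := fun N => {φ | ∀ n ≥ N, ∀ m ≥ N,
    |∫ x, φ.1 x * g n x ∂μ - ∫ x, φ.1 x * g m x ∂μ| ≤ ε'}
  have hFc : ∀ N, IsClosed (F N) := by
    intro N
    refine IsSeqClosed.isClosed ?_
    intro φ φ₀ hφ hlim
    have hlim' : Tendsto (fun k => (φ k).1) atTop (𝓝 φ₀.1) :=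
      (continuous_subtype_val.tendsto _).comp hlim
    -- An a.e. convergent subsequence suffices, with |g n| as dominating function: weights take
    -- values in [0, 1].
    obtain ⟨ns, -, hns⟩ := (tendstoInMeasure_of_tendsto_Lp hlim').exists_seq_tendsto_ae
    have key : ∀ n, Tendsto (fun k => ∫ x, (φ (ns k)).1 x * g n x ∂μ) atTop
        (𝓝 (∫ x, φ₀.1 x * g n x ∂μ)) := by
      intro n
      refine tendsto_integral_of_dominated_convergence (fun x => ‖g n x‖)
        (fun k => ((Lp.aestronglyMeasurable _).mul (hg n).aestronglyMeasurable))
        (hg n).norm ?_ ?_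
      · intro k
        filter_upwards [(hX _).1 (φ (ns k)).2] with x hx
        rw [norm_mul, Real.norm_of_nonneg hx.1]
        exact mul_le_of_le_one_left (norm_nonneg _) hx.2
      · filter_upwards [hns] with x hx
        exact hx.mul_const _
    intro n hn m hm
    exact le_of_tendsto ((key n).sub (key m)).abs (Eventually.of_forall fun k => hφ _ n hn m hm)
  have hFU : ⋃ N, F N = univ := by
    refine eq_univ_of_forall fun φ => ?_
    obtain ⟨N, hN⟩ := Metric.cauchySeq_iff.1
      (H φ.1 (Lp.aestronglyMeasurable _) ((hX _).1 φ.2)) ε' hε'0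
    exact mem_iUnion.2 ⟨N, fun n hn m hm => (hN n hn m hm).le⟩
  have hne : Nonempty X := ⟨⟨0, (hX 0).2 (by
    filter_upwards [Lp.coeFn_zero ℝ 1 μ] with x hx
    rw [hx]; simp)⟩⟩
  obtain ⟨N, φ₀, hφ₀⟩ := nonempty_interior_of_iUnion_of_closed hFc hFU
  obtain ⟨r, hr, hball⟩ := Metric.mem_nhds_iff.1 (mem_interior_iff_mem_nhds.1 hφ₀)
  have hφ₀' := (hX _).1 φ₀.2
  -- replacing the values of `φ₀` on a small set by a constant in `[0, 1]`
  have hmod : ∀ A : Set α, MeasurableSet A → μ.real A < r → ∀ c ∈ Icc (0 : ℝ) 1,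
      ∀ n ≥ N, ∀ m ≥ N,
        |∫ x, A.piecewise (fun _ => c) φ₀.1 x * g n x ∂μ -
          ∫ x, A.piecewise (fun _ => c) φ₀.1 x * g m x ∂μ| ≤ ε' := by
    intro A hA hAr c hc n hn m hm
    set ψ : α → ℝ := A.piecewise (fun _ => c) φ₀.1 with hψ
    have hψm : AEStronglyMeasurable ψ μ :=
      ((stronglyMeasurable_const).piecewise hA (Lp.stronglyMeasurable _)).aestronglyMeasurable
    have hψ01 : ∀ᵐ x ∂μ, ψ x ∈ Icc (0 : ℝ) 1 := by
      filter_upwards [hφ₀'] with x hx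
      by_cases hxA : x ∈ A
      · rw [hψ, piecewise_eq_of_mem _ _ _ hxA]; exact hc
      · rw [hψ, piecewise_eq_of_notMem _ _ _ hxA]; exact hx
    have hψL : MemLp ψ 1 μ := by
      refine memLp_one_iff_integrable.2 (Integrable.of_bound hψm 1 ?_)
      filter_upwards [hψ01] with x hx
      rw [Real.norm_of_nonneg hx.1]; exact hx.2
    have hcoe := hψL.coeFn_toLp
    let Ψ : X := ⟨hψL.toLp ψ, (hX _).2 (by
      filter_upwards [hcoe, hψ01] with x h1 h2
      rw [h1]; exact h2)⟩
    have hd : dist Ψ φ₀ < r := by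
      refine lt_of_le_of_lt ?_ hAr
      change dist (hψL.toLp ψ) φ₀.1 ≤ _
      rw [dist_eq_norm, L1.norm_eq_integral_norm, ← integral_indicator_one hA]
      refine integral_mono_ae (L1.integrable_coeFn _).norm
        ((integrable_const (1 : ℝ)).indicator hA) ?_
      filter_upwards [Lp.coeFn_sub (hψL.toLp ψ) φ₀.1, hcoe, hφ₀', hψ01] with x h1 h2 h3 h4
      rw [h1, Pi.sub_apply, h2]
      by_cases hxA : x ∈ A
      · rw [indicator_of_mem hxA]
        simp only [Pi.one_apply, Real.norm_eq_abs, abs_le]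
        constructor <;> linarith [h3.1, h3.2, h4.1, h4.2]
      · rw [indicator_of_notMem hxA, hψ, piecewise_eq_of_notMem _ _ _ hxA]; simp
    have hmem := hball hd n hn m hm
    have e : ∀ k, ∫ x, Ψ.1 x * g k x ∂μ = ∫ x, ψ x * g k x ∂μ := fun k =>
      integral_congr_ae (by filter_upwards [hcoe] with x hx; rw [hx])
    rwa [e, e] at hmem
  have hset : ∀ A : Set α, MeasurableSet A → μ.real A < r → ∀ n ≥ N,
      |∫ x in A, g n x ∂μ - ∫ x in A, g N x ∂μ| ≤ 2 * ε' := by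
    intro A hA hAr n hn
    have h1 := hmod A hA hAr 1 (by simp) n hn N le_rfl
    have h0 := hmod A hA hAr 0 (by simp) n hn N le_rfl
    have hpi : ∀ c ∈ Icc (0 : ℝ) 1, ∀ k,
        Integrable (fun x => A.piecewise (fun _ => c) φ₀.1 x * g k x) μ := by
      intro c hc k
      refine hint _ ((stronglyMeasurable_const).piecewise hA
        (Lp.stronglyMeasurable _)).aestronglyMeasurable ?_ k
      filter_upwards [hφ₀'] with x hx
      by_cases hxA : x ∈ A
      · rw [piecewise_eq_of_mem _ _ _ hxA]; exact hc
      · rw [piecewise_eq_of_notMem _ _ _ hxA]; exact hx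
    -- The modifications by 1 and by 0 differ by the indicator of `A`, so `φ₀` cancels and the two
    -- errors `ε'` add up.
    have e : ∀ k, ∫ x in A, g k x ∂μ = ∫ x, A.piecewise (fun _ => (1 : ℝ)) φ₀.1 x * g k x ∂μ -
        ∫ x, A.piecewise (fun _ => (0 : ℝ)) φ₀.1 x * g k x ∂μ := by
      intro k
      rw [← integral_sub (hpi 1 (by simp) k) (hpi 0 (by simp) k), ← integral_indicator hA]
      refine integral_congr_ae (Eventually.of_forall fun x => ?_)
      by_cases hxA : x ∈ A <;> simp [hxA]
    rw [e, e]
    rw [abs_le] at *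
    constructor <;> linarith [h1.1, h1.2, h0.1, h0.2]
  -- The finitely many indices up to `N` are handled directly; the later ones are compared with `g
  -- N`.
  obtain ⟨δ₀, hδ₀, hfin⟩ := unifIntegrable_finite (μ := μ) (le_refl 1) ENNReal.one_ne_top
    (f := fun i : Fin (N + 1) => g i) (fun i => memLp_one_iff_integrable.2 (hg i)) hε'0
  refine ⟨min δ₀ (r / 2), by positivity, fun n A hA hμA => ?_⟩
  have hsmall : ∀ B ⊆ A, MeasurableSet B → ∀ i ≤ N, |∫ x in B, g i x ∂μ| ≤ ε' := by
    intro B hB hBm i hi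
    have h := hfin ⟨i, Nat.lt_succ_of_le hi⟩ B hBm (((measure_mono hB).trans hμA).trans
      (ENNReal.ofReal_le_ofReal (min_le_left _ _)))
    rw [eLpNorm_indicator_eq_eLpNorm_restrict hBm, eLpNorm_one_eq_lintegral_enorm,
      ← ofReal_integral_norm_eq_lintegral_enorm (hg i).integrableOn,
      ENNReal.ofReal_le_ofReal_iff hε'0.le] at h
    exact (norm_integral_le_integral_norm _).trans h
  have hAr : ∀ B ⊆ A, μ.real B < r := by
    intro B hB
    have : μ B ≤ ENNReal.ofReal (r / 2) := ((measure_mono hB).trans hμA).trans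
      (ENNReal.ofReal_le_ofReal (min_le_right _ _))
    have := ENNReal.toReal_le_of_le_ofReal (by positivity) this
    rw [Measure.real]; linarith
  have hfinal : ∀ B ⊆ A, MeasurableSet B → |∫ x in B, g n x ∂μ| ≤ 3 * ε' := by
    intro B hB hBm
    have h2 := hsmall B hB hBm N le_rfl
    rcases le_total N n with hn | hn
    · have h1 := hset B hBm (hAr B hB) n hn
      rw [abs_le] at *
      constructor <;> linarith [h1.1, h1.2, h2.1, h2.2]
    · exact (hsmall B hB hBm n hn).trans (by linarith)
  refine (eLpNorm_one_indicator_le_of_abs_setIntegral_le (hg n) (hgm n) hA hfinal).trans (ENNReal.ofReal_le_ofReal ?_)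
  rw [hε']; linarith

/-- De la Vallée-Poussin: a uniformly integrable family has uniformly bounded integrals
of a superlinear function. -/
theorem exists_superlinear_of_uniformIntegrable {ι E : Type*} [NormedAddCommGroup E]
    {f : ι → α → E} (hf : UniformIntegrable f 1 μ) :
    ∃ Φ : ℝ≥0 → ℝ≥0∞, Measurable Φ ∧ (∀ c : ℝ≥0, ∃ R : ℝ≥0, ∀ r ≥ R, (c * r : ℝ≥0) ≤ Φ r) ∧
      ∀ i, ∫⁻ x, Φ ‖f i x‖₊ ∂μ ≤ 2 := by
  have h4 : ∀ m : ℕ, (0 : ℝ) < (1 / 4) ^ m := fun m => by positivity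
  -- The tail of `f i` above level `C m` has L¹ norm at most 4⁻ᵐ; with weight 2ᵐ it contributes 2⁻ᵐ,
  -- and the sum is 2.
  choose C hC using fun m : ℕ => hf.spec one_ne_zero ENNReal.one_ne_top (h4 m)
  have hmeas : ∀ m : ℕ, Measurable fun r : ℝ≥0 =>
      (2 : ℝ≥0∞) ^ m * (Ici (C m)).indicator (fun r => (r : ℝ≥0∞)) r := fun m =>
    (measurable_coe_nnreal_ennreal.indicator measurableSet_Ici).const_mul _
  refine ⟨fun r => ∑' m : ℕ, 2 ^ m * (Ici (C m)).indicator (fun r => (r : ℝ≥0∞)) r,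
    Measurable.tsum hmeas, fun c => ?_, fun i => ?_⟩
  · obtain ⟨m, hm⟩ := pow_unbounded_of_one_lt c (one_lt_two)
    refine ⟨C m, fun r hr => le_trans ?_ (ENNReal.le_tsum m)⟩
    rw [indicator_of_mem (mem_Ici.2 hr), ENNReal.coe_mul]
    gcongr
    exact_mod_cast hm.le
  · have hfm : AEMeasurable (fun x => ‖f i x‖₊) μ := (hf.1 i).nnnorm.aemeasurable
    change ∫⁻ x, ∑' m : ℕ, ((fun r : ℝ≥0 => (2 : ℝ≥0∞) ^ m *
      (Ici (C m)).indicator (fun r => (r : ℝ≥0∞)) r) ∘ fun x => ‖f i x‖₊) x ∂μ ≤ 2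
    rw [lintegral_tsum fun m => (hmeas m).comp_aemeasurable hfm]
    refine (ENNReal.tsum_le_tsum (g := fun m : ℕ => (2 : ℝ≥0∞)⁻¹ ^ m) fun m => ?_).trans ?_
    · change ∫⁻ x, (2 : ℝ≥0∞) ^ m *
        ((Ici (C m)).indicator (fun r => (r : ℝ≥0∞)) ∘ fun x => ‖f i x‖₊) x ∂μ ≤ _
      rw [lintegral_const_mul'' _
        ((measurable_coe_nnreal_ennreal.indicator measurableSet_Ici).comp_aemeasurable hfm)]
      have h := hC m i
      rw [eLpNorm_one_eq_lintegral_enorm] at h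
      have e : ∀ x, (Ici (C m)).indicator (fun r => (r : ℝ≥0∞)) ‖f i x‖₊ =
          ‖({x | C m ≤ ‖f i x‖₊}.indicator (f i)) x‖ₑ := by
        intro x
        by_cases hx : C m ≤ ‖f i x‖₊
        · rw [indicator_of_mem (mem_Ici.2 hx), indicator_of_mem (s := {x | C m ≤ ‖f i x‖₊}) hx]; rfl
        · rw [indicator_of_notMem (s := Ici (C m)) hx,
            indicator_of_notMem (s := {x | C m ≤ ‖f i x‖₊}) hx]
          simp
      simp only [Function.comp_apply, e]
      refine (mul_le_mul_right h _).trans (le_of_eq ?_)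
      rw [ENNReal.ofReal_pow (by norm_num), ← mul_pow]
      congr 1
      rw [ENNReal.ofReal_div_of_pos (by norm_num)]
      norm_num
      rw [show (4 : ℝ≥0∞) = 2 * 2 by norm_num, ENNReal.mul_inv (by simp) (by simp), ← mul_assoc,
        ENNReal.mul_inv_cancel (by simp) (by simp), one_mul]
    · rw [ENNReal.tsum_geometric, ENNReal.one_sub_inv_two, inv_inv]

end UniformIntegrability

/-! ### Weak convergence in L^q implies uniform integrability. -/

section WeakConvergence

variable {d : ℕ} {a b : ℝ} {q : ℝ≥0∞} [hq : Fact (1 ≤ q)]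

theorem Lp.integrable_coeFn (v : Lp (Rd d) q (lebesgue a b)) :
    Integrable v (lebesgue a b) := (Lp.memLp v).integrable hq.out

/-- Integration of a coordinate against a bounded weight, as a functional on `L^q`. -/
theorem exists_clm_integral_mul (φ : Icc a b → ℝ) (hφ : AEStronglyMeasurable φ (lebesgue a b))
    (hφ1 : ∀ᵐ t ∂(lebesgue a b), φ t ∈ Icc (0 : ℝ) 1) (j : Fin d) :
    ∃ l : StrongDual ℝ (Lp (Rd d) q (lebesgue a b)),
      ∀ v, l v = ∫ t, φ t * v t j ∂(lebesgue a b) := by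
  obtain ⟨C, -, hC⟩ := W1q.exists_integral_norm_le (d := d) (a := a) (b := b) hq
  have hb : ∀ᵐ t ∂(lebesgue a b), ‖φ t‖ ≤ 1 := by
    filter_upwards [hφ1] with t ht
    rw [Real.norm_of_nonneg ht.1]; exact ht.2
  have hi : ∀ v : Lp (Rd d) q (lebesgue a b),
      Integrable (fun t => φ t * v t j) (lebesgue a b) := fun v =>
    ((EuclideanSpace.proj (𝕜 := ℝ) j).integrable_comp (Lp.integrable_coeFn v)).bdd_mul hφ hb
  refine ⟨LinearMap.mkContinuous
    { toFun := fun v => ∫ t, φ t * v t j ∂(lebesgue a b)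
      map_add' := fun v w => ?_
      map_smul' := fun c v => ?_ } C fun v => ?_, fun v => rfl⟩
  · rw [← integral_add (hi v) (hi w)]
    refine integral_congr_ae ?_
    filter_upwards [Lp.coeFn_add v w] with t ht
    rw [ht]; simp [mul_add]
  · rw [RingHom.id_apply, smul_eq_mul, ← integral_const_mul]
    refine integral_congr_ae ?_
    filter_upwards [Lp.coeFn_smul c v] with t ht
    rw [ht]; simp; ring
  · refine le_trans ?_ (hC v)
    refine (norm_integral_le_integral_norm _).trans
      (integral_mono_ae (hi v).norm (Lp.integrable_coeFn v).norm ?_)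
    filter_upwards [hb] with t ht
    rw [norm_mul]
    exact (mul_le_of_le_one_left (norm_nonneg _) ht).trans (PiLp.norm_apply_le _ _)

/-- Banach–Steinhaus on the dual space, the embedding into the bidual being isometric. -/
theorem exists_norm_le_of_tendsto_weak {E : Type*} [NormedAddCommGroup E] [NormedSpace ℝ E]
    {v : ℕ → E} {v₀ : E} (h : ∀ l : StrongDual ℝ E, Tendsto (fun n => l (v n)) atTop (𝓝 (l v₀))) :
    ∃ C, ∀ n, ‖v n‖ ≤ C := by
  obtain ⟨C, hC⟩ := banach_steinhaus (g := fun n => NormedSpace.inclusionInDoubleDual ℝ E (v n))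
    (fun l => by
      obtain ⟨C, hC⟩ := (h l).norm.bddAbove_range
      exact ⟨C, fun n => hC ⟨n, rfl⟩⟩)
  refine ⟨C, fun n => le_trans (le_of_eq ?_) (hC n)⟩
  exact ((NormedSpace.inclusionInDoubleDualLi ℝ (E := E)).norm_map (v n)).symm

/-- Weakly convergent sequences in `L^q` are uniformly integrable. -/
theorem uniformIntegrable_of_tendsto_weak {v : ℕ → Lp (Rd d) q (lebesgue a b)}
    {v₀ : Lp (Rd d) q (lebesgue a b)}
    (h : ∀ l : StrongDual ℝ (Lp (Rd d) q (lebesgue a b)),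
      Tendsto (fun n => l (v n)) atTop (𝓝 (l v₀))) :
    UniformIntegrable (fun n t => v n t) 1 (lebesgue a b) := by
  refine ⟨fun n => Lp.aestronglyMeasurable _, ?_, ?_⟩
  · have hc : ∀ j : Fin d, UnifIntegrable (fun n t => v n t j) 1 (lebesgue a b) := by
      intro j
      refine unifIntegrable_of_cauchySeq_integral_mul (fun n => ?_) (fun n => ?_) ?_
      · exact (EuclideanSpace.proj (𝕜 := ℝ) j).continuous.measurable.comp
          (Lp.stronglyMeasurable _).measurable
      · exact (EuclideanSpace.proj (𝕜 := ℝ) j).integrable_comp (Lp.integrable_coeFn (v n))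
      · intro φ hφ hφ1
        obtain ⟨l, hl⟩ := exists_clm_integral_mul (q := q) φ hφ hφ1 j
        have := (h l).cauchySeq
        simpa only [hl] using this
    intro ε hε
    -- Each of the `d` coordinates gets this share; `d + 1` covers `d = 0`.
    have hε' : 0 < ε / (d + 1) := by positivity
    choose δ hδ0 hδ using fun j => hc j hε'
    obtain ⟨δ₀, hδ₀, hle⟩ : ∃ δ₀ > 0, ∀ j, δ₀ ≤ δ j := by
      rcases isEmpty_or_nonempty (Fin d) with he | hne
      · exact ⟨1, one_pos, fun j => he.elim j⟩
      · obtain ⟨j₀, hj₀⟩ := Finite.exists_min δ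
        exact ⟨δ j₀, hδ0 j₀, hj₀⟩
    refine ⟨δ₀, hδ₀, fun n A hA hμ => ?_⟩
    have hsum : eLpNorm (A.indicator fun t => v n t) 1 (lebesgue a b) ≤
        ∑ j : Fin d, eLpNorm (A.indicator fun t => v n t j) 1 (lebesgue a b) := by
      simp only [eLpNorm_one_eq_lintegral_enorm]
      rw [← lintegral_finsetSum']
      · refine lintegral_mono fun t => ?_
        by_cases ht : t ∈ A
        · simp only [indicator_of_mem ht]
          simp only [← ofReal_norm, ← ENNReal.ofReal_sum_of_nonneg fun j _ => norm_nonneg _]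
          refine ENNReal.ofReal_le_ofReal ?_
          calc ‖v n t‖ = ‖∑ j, (v n t) j • EuclideanSpace.basisFun (Fin d) ℝ j‖ := by
                  congr 1
                  exact ((EuclideanSpace.basisFun (Fin d) ℝ).sum_repr (v n t)).symm
            _ ≤ ∑ j, ‖(v n t) j • EuclideanSpace.basisFun (Fin d) ℝ j‖ := norm_sum_le _ _
            _ = ∑ j, ‖(v n t) j‖ := by simp [norm_smul]
        · simp [indicator_of_notMem ht]
      · intro j _
        exact (((EuclideanSpace.proj (𝕜 := ℝ) j).continuous.measurable.comp
          (Lp.stronglyMeasurable (v n)).measurable).indicator hA).enorm.aemeasurable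
    refine hsum.trans ((Finset.sum_le_sum fun j _ => hδ j n A hA
      (hμ.trans (ENNReal.ofReal_le_ofReal (hle j)))).trans ?_)
    rw [Finset.sum_const, Finset.card_univ, Fintype.card_fin, nsmul_eq_mul,
      ← ENNReal.ofReal_natCast, ← ENNReal.ofReal_mul (by positivity)]
    refine ENNReal.ofReal_le_ofReal ?_
    rw [mul_div_assoc', div_le_iff₀ (by positivity)]
    nlinarith
  · obtain ⟨C, hC⟩ := exists_norm_le_of_tendsto_weak h
    obtain ⟨C', hC'0, hC'⟩ := W1q.exists_integral_norm_le (d := d) (a := a) (b := b) hq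
    refine ⟨(C' * C).toNNReal, fun n => ?_⟩
    rw [eLpNorm_one_eq_lintegral_enorm,
      ← ofReal_integral_norm_eq_lintegral_enorm (Lp.integrable_coeFn (v n))]
    exact ENNReal.ofReal_le_ofReal ((hC' _).trans (mul_le_mul_of_nonneg_left (hC n) hC'0))

end WeakConvergence

/-! ### Affine minorants, Mazur's lemma and superlinear penalization. -/

section Convexity

variable {E : Type*} [NormedAddCommGroup E] [NormedSpace ℝ E]

/-- A convex sequentially l.s.c. function with values in `[0, ∞]` is the supremum of the
positive parts of its continuous affine minorants. -/
theorem ConvexOn.exists_affine_minorant {F : E → ℝ≥0∞} (hconv : ConvexOn ℝ≥0 univ F)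
    (hlsc : SeqLSC F) {v : E} {c : ℝ≥0∞} (hc : c < F v) :
    ∃ (p : StrongDual ℝ E) (β : ℝ), (∀ z, ENNReal.ofReal (p z + β) ≤ F z) ∧
      c < ENNReal.ofReal (p v + β) := by
  have hct : c ≠ ∞ := hc.ne_top
  set c' := c.toReal with hc'
  have hcc : c = ENNReal.ofReal c' := (ENNReal.ofReal_toReal hct).symm
  have hc0 : 0 ≤ c' := ENNReal.toReal_nonneg
  -- The real epigraph of `F`, to be separated from `(v, c')`. Heights are kept nonnegative because
  -- `ENNReal.ofReal` identifies all negative ones with 0.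
  let S : Set (E × ℝ) := {x | 0 ≤ x.2 ∧ F x.1 ≤ ENNReal.ofReal x.2}
  have hmemS : ∀ z, F z ≠ ∞ → (z, (F z).toReal) ∈ S := fun z hz =>
    ⟨ENNReal.toReal_nonneg, (ENNReal.ofReal_toReal hz).ge⟩
  have hSconv : Convex ℝ S := by
    rintro ⟨z₁, r₁⟩ ⟨h1, h1'⟩ ⟨z₂, r₂⟩ ⟨h2, h2'⟩ s t hs ht hst
    dsimp only at h1 h1' h2 h2'
    refine ⟨by simp only [Prod.smul_mk, Prod.mk_add_mk, smul_eq_mul]; positivity, ?_⟩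
    lift s to ℝ≥0 using hs
    lift t to ℝ≥0 using ht
    have := hconv.2 (mem_univ z₁) (mem_univ z₂) (zero_le (a := s)) (zero_le (a := t))
      (by exact_mod_cast hst)
    refine this.trans ?_
    simp only [Prod.smul_mk, Prod.mk_add_mk, smul_eq_mul]
    rw [ENNReal.ofReal_add (by positivity) (by positivity), ENNReal.ofReal_mul (NNReal.coe_nonneg s),
      ENNReal.ofReal_mul (NNReal.coe_nonneg t), ENNReal.ofReal_coe_nnreal, ENNReal.ofReal_coe_nnreal,
      ENNReal.smul_def, ENNReal.smul_def, smul_eq_mul, smul_eq_mul]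
    gcongr
  have hScl : IsClosed S := by
    refine IsSeqClosed.isClosed ?_
    intro x x₀ hx hlim
    have h1 : Tendsto (fun n => (x n).1) atTop (𝓝 x₀.1) := (continuous_fst.tendsto _).comp hlim
    have h2 : Tendsto (fun n => (x n).2) atTop (𝓝 x₀.2) := (continuous_snd.tendsto _).comp hlim
    refine ⟨ge_of_tendsto' h2 fun n => (hx n).1, (hlsc _ _ h1).trans ?_⟩
    rw [← ((ENNReal.continuous_ofReal.tendsto _).comp h2).liminf_eq]
    exact liminf_le_liminf (Eventually.of_forall fun n => (hx n).2)
  have hv : (v, c') ∉ S := fun h => by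
    have := h.2
    rw [← hcc] at this
    exact this.not_gt hc
  obtain ⟨f, u, hfu, hf⟩ := geometric_hahn_banach_point_closed hSconv hScl hv
  set p : StrongDual ℝ E := f.comp (ContinuousLinearMap.inl ℝ E ℝ) with hp
  set α : ℝ := f (0, 1) with hα
  have hdec : ∀ z r, f (z, r) = p z + α * r := by
    intro z r
    have : ((z, r) : E × ℝ) = (z, 0) + r • (0, 1) := by simp
    rw [this, map_add, map_smul, smul_eq_mul, mul_comm]
    rfl
  have hfin : ∀ z, F z ≠ ∞ → u < p z + α * (F z).toReal := fun z hz => by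
    rw [← hdec]; exact hf _ (hmemS z hz)
  rw [hdec] at hfu
  by_cases hemp : ∀ z, F z = ∞
  · refine ⟨0, c' + 1, fun z => by rw [hemp]; exact le_top, ?_⟩
    rw [hcc]
    refine (ENNReal.ofReal_lt_ofReal_iff (by simp; positivity)).2 (by simp)
  push Not at hemp
  obtain ⟨z₀, hz₀⟩ := hemp
  -- The epigraph is unbounded upwards.
  have hα0 : 0 ≤ α := by
    by_contra! hneg
    obtain ⟨n, hn⟩ := exists_nat_gt ((p z₀ + α * (F z₀).toReal - u) / (-α))
    have hmem : (z₀, (F z₀).toReal + n) ∈ S :=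
      ⟨by dsimp only; positivity, (hmemS z₀ hz₀).2.trans (ENNReal.ofReal_le_ofReal (by simp))⟩
    have h := hf _ hmem
    rw [hdec] at h
    rw [div_lt_iff₀ (by linarith)] at hn
    linarith
  -- If `α = 0` the hyperplane is vertical and separates `v` from the domain of `F`; it is scaled to
  -- be nonpositive on the domain and `c' + 1` at `v`. Otherwise it is the graph of an affine
  -- function.
  rcases hα0.eq_or_lt with hz | hpos
  · rw [← hz] at hfu hfin
    have hd : 0 < u - p v := by linarith
    have key : ∀ z, ((-((c' + 1) / (u - p v))) • p) z + (c' + 1) / (u - p v) * u =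
        (c' + 1) / (u - p v) * (u - p z) := fun z => by simp; ring
    refine ⟨(-((c' + 1) / (u - p v))) • p, (c' + 1) / (u - p v) * u, fun z => ?_, ?_⟩
    · by_cases hzt : F z = ∞
      · rw [hzt]; exact le_top
      · rw [key, ENNReal.ofReal_of_nonpos]
        · exact zero_le
        · have := hfin z hzt
          exact mul_nonpos_of_nonneg_of_nonpos (by positivity) (by linarith)
    · rw [key, hcc, div_mul_cancel₀ _ hd.ne']
      exact (ENNReal.ofReal_lt_ofReal_iff (by positivity)).2 (by simp)
  · have key : ∀ z, ((-α⁻¹) • p) z + α⁻¹ * u = α⁻¹ * (u - p z) := fun z => by simp; ring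
    refine ⟨(-α⁻¹) • p, α⁻¹ * u, fun z => ?_, ?_⟩
    · by_cases hzt : F z = ∞
      · rw [hzt]; exact le_top
      · rw [key, ← ENNReal.ofReal_toReal hzt]
        refine ENNReal.ofReal_le_ofReal ?_
        rw [inv_mul_le_iff₀ hpos]
        linarith [hfin z hzt]
    · have : c' < α⁻¹ * (u - p v) := by
        rw [lt_inv_mul_iff₀ hpos]; linarith
      rw [key, hcc]
      exact (ENNReal.ofReal_lt_ofReal_iff (hc0.trans_lt this)).2 this

/-- Mazur's lemma, with explicit convex combinations of tails. -/
theorem exists_convexCombination_tendsto {v : ℕ → E} {v₀ : E}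
    (h : ∀ l : StrongDual ℝ E, Tendsto (fun n => l (v n)) atTop (𝓝 (l v₀))) :
    ∃ (s : ℕ → Finset ℕ) (w : ℕ → ℕ → ℝ≥0), (∀ k, ∀ i ∈ s k, k ≤ i) ∧
      (∀ k, ∑ i ∈ s k, w k i = 1) ∧
      Tendsto (fun k => ∑ i ∈ s k, (w k i : ℝ) • v i) atTop (𝓝 v₀) := by
  have hcl : ∀ k, v₀ ∈ closure (convexHull ℝ (v '' Ici k)) := by
    intro k
    by_contra hv
    obtain ⟨l, u, hu, hl⟩ := geometric_hahn_banach_point_closed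
      (convex_convexHull ℝ (v '' Ici k)).closure isClosed_closure hv
    refine hu.not_ge (ge_of_tendsto (h l) ?_)
    filter_upwards [eventually_ge_atTop k] with n hn
    exact (hl _ (subset_closure (subset_convexHull _ _ ⟨n, hn, rfl⟩))).le
  have hrep : ∀ k, ∀ x ∈ convexHull ℝ (v '' Ici k), ∃ (s : Finset ℕ) (w : ℕ → ℝ≥0),
      (∀ i ∈ s, k ≤ i) ∧ ∑ i ∈ s, w i = 1 ∧ ∑ i ∈ s, (w i : ℝ) • v i = x := by
    classical
    intro k x hx
    rw [convexHull_eq] at hx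
    obtain ⟨ι, t, w, z, hw0, hw1, hz, hx⟩ := hx
    choose! n hn hnz using hz
    -- Several points of the combination may have the same index; their weights are added up.
    refine ⟨t.image n, fun m => ∑ i ∈ t with n i = m, (w i).toNNReal, ?_, ?_, ?_⟩
    · intro m hm
      obtain ⟨i, hi, rfl⟩ := Finset.mem_image.1 hm
      exact hn i hi
    · rw [Finset.sum_fiberwise_of_maps_to fun i hi => Finset.mem_image_of_mem n hi,
        ← NNReal.coe_inj, NNReal.coe_sum, NNReal.coe_one, ← hw1]
      exact Finset.sum_congr rfl fun i hi => Real.coe_toNNReal _ (hw0 i hi)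
    · rw [← hx, Finset.centerMass_eq_of_sum_1 _ _ hw1,
        ← Finset.sum_fiberwise_of_maps_to fun i hi => Finset.mem_image_of_mem n hi]
      refine Finset.sum_congr rfl fun m _ => ?_
      rw [NNReal.coe_sum, Finset.sum_smul]
      refine Finset.sum_congr rfl fun i hi => ?_
      rw [Finset.mem_filter] at hi
      rw [Real.coe_toNNReal _ (hw0 i hi.1), ← hnz i hi.1, hi.2]
  have hex : ∀ k : ℕ, ∃ (s : Finset ℕ) (w : ℕ → ℝ≥0), (∀ i ∈ s, k ≤ i) ∧ ∑ i ∈ s, w i = 1 ∧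
      dist (∑ i ∈ s, (w i : ℝ) • v i) v₀ < 1 / ((k : ℝ) + 1) := by
    intro k
    obtain ⟨x, hx, hd⟩ := Metric.mem_closure_iff.1 (hcl k) (1 / ((k : ℝ) + 1)) (by positivity)
    obtain ⟨s, w, h1, h2, h3⟩ := hrep k x hx
    exact ⟨s, w, h1, h2, by rw [h3, dist_comm]; exact hd⟩
  choose s w h1 h2 h3 using hex
  exact ⟨s, w, h1, h2, tendsto_iff_dist_tendsto_zero.2 (squeeze_zero (fun _ => dist_nonneg)
    (fun k => (h3 k).le) tendsto_one_div_add_atTop_nhds_zero_nat)⟩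

/-- Adding a superlinear penalization, affine minorants of the lower limit are eventually
minorants of the sequence. -/
theorem exists_affine_minorant_add_superlinear [ProperSpace E] {Fi : ℕ → E → ℝ≥0∞}
    {F : E → ℝ≥0∞} (hconv : ConvexOn ℝ≥0 univ F) (hlsc : SeqLSC F)
    (hlim : ∀ (n : ℕ → ℕ) (z : ℕ → E) (z₀ : E), Tendsto n atTop atTop → Tendsto z atTop (𝓝 z₀) →
      F z₀ ≤ liminf (fun j => Fi (n j) (z j)) atTop)
    {Φ : ℝ≥0 → ℝ≥0∞} (hΦ : ∀ c : ℝ≥0, ∃ R : ℝ≥0, ∀ r ≥ R, (c * r : ℝ≥0) ≤ Φ r)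
    {ε : ℝ≥0} (hε : 0 < ε) {v : E} {c : ℝ≥0∞} (hc : c < F v) :
    ∃ (p : StrongDual ℝ E) (β : ℝ) (k : ℕ), c < ENNReal.ofReal (p v + β) ∧
      ∀ i ≥ k, ∀ z, ENNReal.ofReal (p z + β) ≤ Fi i z + ε * Φ ‖z‖₊ := by
  obtain ⟨p, β₀, hmin, hcv⟩ := hconv.exists_affine_minorant hlsc hc
  -- Lowering the constant leaves a strict gap below `F`, which the compactness argument
  -- contradicts.
  obtain ⟨β, hβ, hcβ⟩ : ∃ β < β₀, c < ENNReal.ofReal (p v + β) := by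
    have hcont : Tendsto (fun β => ENNReal.ofReal (p v + β)) (𝓝[<] β₀)
        (𝓝 (ENNReal.ofReal (p v + β₀))) :=
      ((ENNReal.continuous_ofReal.comp (continuous_const.add continuous_id)).tendsto β₀).mono_left
        nhdsWithin_le_nhds
    obtain ⟨β, h1, h2⟩ := ((hcont.eventually (lt_mem_nhds hcv)).and self_mem_nhdsWithin).exists
    exact ⟨β, h2, h1⟩
  -- For ‖z‖ ≥ 1 one has p z + β ≤ (‖p‖ + |β|) ‖z‖, and this slope is divided by the factor `ε` of
  -- the penalty.
  obtain ⟨R, hR⟩ := hΦ ((‖p‖₊ + ‖β‖₊) / ε)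
  have hlarge : ∀ z : E, max R 1 ≤ ‖z‖₊ → ENNReal.ofReal (p z + β) ≤ ε * Φ ‖z‖₊ := by
    intro z hz
    have h1 := hR _ ((le_max_left _ _).trans hz)
    have h2 : p z + β ≤ (((‖p‖₊ + ‖β‖₊) * ‖z‖₊ : ℝ≥0) : ℝ) := by
      have a1 : p z ≤ ‖p‖ * ‖z‖ := (le_abs_self _).trans (p.le_opNorm z)
      have a2 : β ≤ ‖β‖ := le_abs_self _
      have a3 : (1 : ℝ) ≤ ‖z‖ := by exact_mod_cast (le_max_right R 1).trans hz
      have a4 : 0 ≤ ‖β‖ := norm_nonneg _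
      push_cast
      nlinarith
    calc ENNReal.ofReal (p z + β) ≤ (((‖p‖₊ + ‖β‖₊) * ‖z‖₊ : ℝ≥0) : ℝ≥0∞) := by
          rw [← ENNReal.ofReal_coe_nnreal]; exact ENNReal.ofReal_le_ofReal h2
      _ = ε * (((‖p‖₊ + ‖β‖₊) / ε * ‖z‖₊ : ℝ≥0) : ℝ≥0∞) := by
          rw [← ENNReal.coe_mul]
          congr 1
          field_simp
      _ ≤ ε * Φ ‖z‖₊ := by gcongr
  -- Otherwise violating points have a subsequence converging to some `z₀` in the ball, and then F
  -- z₀ ≤ p z₀ + β < p z₀ + β₀.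
  obtain ⟨k, hk⟩ : ∃ k, ∀ i ≥ k, ∀ z : E, ‖z‖₊ ≤ max R 1 →
      ENNReal.ofReal (p z + β) ≤ Fi i z := by
    by_contra! hcon
    choose n hn z hzR hz using hcon
    have hcpt := isCompact_closedBall (0 : E) (max R 1 : ℝ≥0)
    obtain ⟨z₀, -, ψ, hψ, hzlim⟩ := hcpt.tendsto_subseq (x := z) fun j => by
      rw [mem_closedBall_zero_iff]; exact_mod_cast hzR j
    have hnlim : Tendsto (n ∘ ψ) atTop atTop :=
      (tendsto_atTop_mono hn tendsto_id).comp hψ.tendsto_atTop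
    have hF := hlim (n ∘ ψ) (z ∘ ψ) z₀ hnlim hzlim
    have haff : Tendsto (fun j => p (z (ψ j)) + β) atTop (𝓝 (p z₀ + β)) :=
      ((p.continuous.tendsto _).comp hzlim).add_const β
    have hle : F z₀ ≤ ENNReal.ofReal (p z₀ + β) := by
      refine hF.trans ?_
      rw [← ((ENNReal.continuous_ofReal.tendsto _).comp haff).liminf_eq]
      exact liminf_le_liminf (Eventually.of_forall fun j => (hz (ψ j)).le)
    -- `ENNReal.ofReal` is strictly increasing only on nonnegative reals.
    have hnn : 0 ≤ p z₀ + β := ge_of_tendsto' haff fun j =>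
      (ENNReal.ofReal_pos.1 (zero_le.trans_lt (hz (ψ j)))).le
    refine (hle.trans_lt ?_).not_ge (hmin z₀)
    exact (ENNReal.ofReal_lt_ofReal_iff (by linarith)).2 (by linarith)
  refine ⟨p, β, k, hcβ, fun i hi z => ?_⟩
  rcases le_total ‖z‖₊ (max R 1) with hz | hz
  · exact (hk i hi z hz).trans le_self_add
  · exact (hlarge z hz).trans le_add_self

/-- Since the indices in `s k` are at least `k`, one affine function eventually bounds all terms
from below. Its value at the convex combination is the combination of its values, and it exceeds any
prescribed `c < F v` at `v`. -/
theorem le_liminf_convexCombination [ProperSpace E] {Fi : ℕ → E → ℝ≥0∞}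
    {F : E → ℝ≥0∞} (hconv : ConvexOn ℝ≥0 univ F) (hlsc : SeqLSC F)
    (hlim : ∀ (n : ℕ → ℕ) (z : ℕ → E) (z₀ : E), Tendsto n atTop atTop → Tendsto z atTop (𝓝 z₀) →
      F z₀ ≤ liminf (fun j => Fi (n j) (z j)) atTop)
    {Φ : ℝ≥0 → ℝ≥0∞} (hΦ : ∀ c : ℝ≥0, ∃ R : ℝ≥0, ∀ r ≥ R, (c * r : ℝ≥0) ≤ Φ r)
    {ε : ℝ≥0} (hε : 0 < ε) {s : ℕ → Finset ℕ} {w : ℕ → ℕ → ℝ≥0} (hs : ∀ k, ∀ i ∈ s k, k ≤ i)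
    (hw : ∀ k, ∑ i ∈ s k, w k i = 1) {z : ℕ → E} {v : E}
    (hz : Tendsto (fun k => ∑ i ∈ s k, (w k i : ℝ) • z i) atTop (𝓝 v)) :
    F v ≤ liminf (fun k => ∑ i ∈ s k, w k i * (Fi i (z i) + ε * Φ ‖z i‖₊)) atTop := by
  refine le_of_forall_lt fun c hc => ?_
  obtain ⟨p, β, k₀, hcv, hmin⟩ :=
    exists_affine_minorant_add_superlinear hconv hlsc hlim hΦ hε hc
  have haff : Tendsto (fun k => ENNReal.ofReal (p (∑ i ∈ s k, (w k i : ℝ) • z i) + β)) atTop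
      (𝓝 (ENNReal.ofReal (p v + β))) :=
    (ENNReal.continuous_ofReal.tendsto _).comp (((p.continuous.tendsto _).comp hz).add_const β)
  refine hcv.trans_le ?_
  rw [← haff.liminf_eq]
  refine liminf_le_liminf ?_
  filter_upwards [eventually_ge_atTop k₀] with k hk
  have e : p (∑ i ∈ s k, (w k i : ℝ) • z i) + β = ∑ i ∈ s k, (w k i : ℝ) * (p (z i) + β) := by
    have h1 : ∑ i ∈ s k, (w k i : ℝ) = 1 := by exact_mod_cast hw k
    simp only [map_sum, map_smul, smul_eq_mul, mul_add, Finset.sum_add_distrib,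
      ← Finset.sum_mul, h1, one_mul]
  rw [e]
  refine (Finset.le_sum_of_subadditive ENNReal.ofReal ENNReal.ofReal_zero.le
    (fun _ _ => ENNReal.ofReal_add_le) _ _).trans (Finset.sum_le_sum fun i hi => ?_)
  rw [ENNReal.ofReal_mul (NNReal.coe_nonneg (w k i)), ENNReal.ofReal_coe_nnreal]
  gcongr
  exact hmin i (hk.trans (hs k i hi)) _

end Convexity

/-! ### Ioffe's lower semicontinuity theorem. -/

section Integrand

variable {d : ℕ} {a b : ℝ} {q : ℝ≥0∞} [hq : Fact (1 ≤ q)]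

theorem Lp.coeFn_sum_smul {α E ι : Type*} [MeasurableSpace α] {μ : Measure α}
    [NormedAddCommGroup E] [NormedSpace ℝ E] {p : ℝ≥0∞} (s : Finset ι) (w : ι → ℝ)
    (v : ι → Lp E p μ) :
    ∀ᵐ x ∂μ, (∑ i ∈ s, w i • v i : Lp E p μ) x = ∑ i ∈ s, w i • v i x := by
  classical
  induction s using Finset.induction_on with
  | empty =>
    filter_upwards [Lp.coeFn_zero E p μ] with x hx
    simpa using hx
  | insert j s hj ih =>
    rw [Finset.sum_insert hj]
    filter_upwards [ih, Lp.coeFn_add (w j • v j) (∑ i ∈ s, w i • v i),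
      Lp.coeFn_smul (w j) (v j)] with x h1 h2 h3
    rw [h2, Pi.add_apply, h1, h3, Finset.sum_insert hj, Pi.smul_apply]

/-- Ioffe's lower semicontinuity theorem: only pointwise lower limits and the convexity of the
limiting integrand are needed. -/
theorem lintegral_le_of_tendsto_weak {Fi : ℕ → Icc a b → Rd d → ℝ≥0∞}
    {F : Icc a b → Rd d → ℝ≥0∞} {v : ℕ → Lp (Rd d) q (lebesgue a b)}
    {v₀ : Lp (Rd d) q (lebesgue a b)}
    (hv : ∀ l : StrongDual ℝ (Lp (Rd d) q (lebesgue a b)),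
      Tendsto (fun n => l (v n)) atTop (𝓝 (l v₀)))
    (hconv : ∀ t, ConvexOn ℝ≥0 univ (F t))
    (hlsc : ∀ᵐ t ∂(lebesgue a b), SeqLSC (F t))
    (hlim : ∀ᵐ t ∂(lebesgue a b), ∀ (n : ℕ → ℕ) (z : ℕ → Rd d) (z₀ : Rd d),
      Tendsto n atTop atTop → Tendsto z atTop (𝓝 z₀) →
        F t z₀ ≤ liminf (fun j => Fi (n j) t (z j)) atTop)
    (hmeas : ∀ n, AEMeasurable (fun t => Fi n t (v n t)) (lebesgue a b))
    {c : ℝ≥0∞} (hc : ∀ n, ∫⁻ t, Fi n t (v n t) ∂(lebesgue a b) ≤ c) :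
    ∫⁻ t, F t (v₀ t) ∂(lebesgue a b) ≤ c := by
  obtain ⟨Φ, hΦm, hΦ, hΦ2⟩ :=
    exists_superlinear_of_uniformIntegrable (uniformIntegrable_of_tendsto_weak hv)
  obtain ⟨s, w, hs, hw, hsw⟩ := exists_convexCombination_tendsto hv
  obtain ⟨ns, hns, hae⟩ := (tendstoInMeasure_of_tendsto_Lp hsw).exists_seq_tendsto_ae
  have hsum : ∀ᵐ t ∂(lebesgue a b), ∀ k,
      (∑ i ∈ s k, (w k i : ℝ) • v i : Lp (Rd d) q (lebesgue a b)) t =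
        ∑ i ∈ s k, (w k i : ℝ) • v i t :=
    ae_all_iff.2 fun k => Lp.coeFn_sum_smul (s k) (fun i => (w k i : ℝ)) v
  -- Each penalized integral is at most `c + ε * 2`, hence so is any convex combination of them.
  have hε : ∀ ε : ℝ≥0, 0 < ε → ∫⁻ t, F t (v₀ t) ∂(lebesgue a b) ≤ c + ε * 2 := by
    intro ε hε
    have hm1 : ∀ i, AEMeasurable (fun t => (ε : ℝ≥0∞) * Φ ‖v i t‖₊) (lebesgue a b) := fun i =>
      (hΦm.comp (Lp.stronglyMeasurable (v i)).measurable.nnnorm).const_mul _ |>.aemeasurable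
    have hm2 : ∀ i, AEMeasurable (fun t => Fi i t (v i t) + ε * Φ ‖v i t‖₊) (lebesgue a b) :=
      fun i => (hmeas i).add (hm1 i)
    have hm3 : ∀ k i, AEMeasurable (fun t => w k i * (Fi i t (v i t) + ε * Φ ‖v i t‖₊))
        (lebesgue a b) := fun k i => (hm2 i).const_mul _
    calc ∫⁻ t, F t (v₀ t) ∂(lebesgue a b)
        ≤ ∫⁻ t, liminf (fun k => ∑ i ∈ s (ns k), w (ns k) i *
            (Fi i t (v i t) + ε * Φ ‖v i t‖₊)) atTop ∂(lebesgue a b) := by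
          refine lintegral_mono_ae ?_
          filter_upwards [hlsc, hlim, hae, hsum] with t h1 h2 h3 h4
          simp only [h4] at h3
          exact le_liminf_convexCombination (hconv t) h1 h2 hΦ hε
            (fun k i hi => (hns.id_le k).trans (hs _ i hi)) (fun k => hw _) h3
      _ ≤ liminf (fun k => ∫⁻ t, ∑ i ∈ s (ns k), w (ns k) i *
            (Fi i t (v i t) + ε * Φ ‖v i t‖₊) ∂(lebesgue a b)) atTop :=
          lintegral_liminf_le' fun k => Finset.aemeasurable_fun_sum _ fun i _ => hm3 _ i
      _ ≤ liminf (fun _ : ℕ => c + ε * 2) atTop := by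
          refine liminf_le_liminf (Eventually.of_forall fun k => ?_)
          rw [lintegral_finsetSum' _ fun i _ => hm3 _ i]
          calc ∑ i ∈ s (ns k), ∫⁻ t, w (ns k) i * (Fi i t (v i t) + ε * Φ ‖v i t‖₊) ∂(lebesgue a b)
              ≤ ∑ i ∈ s (ns k), (w (ns k) i : ℝ≥0∞) * (c + ε * 2) := by
                refine Finset.sum_le_sum fun i _ => ?_
                rw [lintegral_const_mul'' _ (hm2 i), lintegral_add_left' (hmeas i),
                  lintegral_const_mul' _ _ ENNReal.coe_ne_top]
                gcongr
                · exact hc i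
                · exact hΦ2 i
            _ = c + ε * 2 := by
                rw [← Finset.sum_mul, ← ENNReal.ofNNReal_finsetSum, hw, ENNReal.coe_one, one_mul]
      _ = c + ε * 2 := by simp
  refine ENNReal.le_of_forall_pos_le_add fun δ hδ _ => ?_
  have := hε (δ / 2) (by positivity)
  rwa [ENNReal.coe_div two_ne_zero, ENNReal.coe_two,
    ENNReal.div_mul_cancel two_ne_zero ENNReal.ofNat_ne_top] at this

end Integrand

/-- Sequential criterion: it suffices to bound subsequences along which the values are bounded. -/
theorem le_liminf_of_forall_subseq_le {u : ℕ → ℝ≥0∞} {x : ℝ≥0∞}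
    (h : ∀ (c : ℝ≥0∞) (φ : ℕ → ℕ), StrictMono φ → (∀ n, u (φ n) ≤ c) → x ≤ c) :
    x ≤ liminf u atTop := by
  refine le_of_forall_gt_imp_ge_of_dense fun c hc => ?_
  obtain ⟨φ, hφ, hφc⟩ := extraction_of_frequently_atTop
    (frequently_lt_of_liminf_lt (by isBoundedDefault) hc)
  exact h c φ hφ fun n => (hφc n).le

/-! ### Semicontinuity and measurability of the multiplicity. -/

section Multiplicity

variable {d : ℕ} {a b : ℝ}

/-- Upper semicontinuity of the multiplicity. -/
theorem eventually_mult_lt {ι : Type*} {l : Filter ι}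
    {η : ι → ProbabilityMeasure (Curves d a b)} {η₀ : ProbabilityMeasure (Curves d a b)}
    (hη : Tendsto η l (𝓝 η₀)) (t : Icc a b) {y : ι → Rd d} {y₀ : Rd d}
    (hy : Tendsto y l (𝓝 y₀)) {c : ℝ} (hc : (mult η₀ t y₀ : ℝ) < c) :
    ∀ᶠ n in l, (mult (η n) t (y n) : ℝ) < c := by
  have hcont : Continuous fun γ : Curves d a b => γ t :=
    ContinuousEvalConst.continuous_eval_const t
  set ν : ProbabilityMeasure (Curves d a b) → ProbabilityMeasure (Rd d) := fun η =>
    η.map (f := fun γ : Curves d a b => γ t) hcont.measurable.aemeasurable with hν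
  have hmult : ∀ η y, ENNReal.ofReal (mult η t y : ℝ) = (ν η : Measure (Rd d)) {y} := by
    intro η y
    rw [← ProbabilityMeasure.ennreal_coeFn_eq_coeFn_toMeasure, ← ENNReal.ofReal_coe_nnreal]
    rfl
  have hνlim : Tendsto (fun n => ν (η n)) l (𝓝 (ν η₀)) :=
    ProbabilityMeasure.tendsto_map_of_tendsto_of_continuous _ _ hη hcont
  have hc0 : 0 < c := (mult η₀ t y₀).2.1.trans_lt hc
  have hlt : (ν η₀ : Measure (Rd d)) {y₀} < ENNReal.ofReal c := by
    rw [← hmult]; exact (ENNReal.ofReal_lt_ofReal_iff hc0).2 hc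
  -- The points `y n` vary, so they are enclosed in one closed ball around `y₀` whose limit mass is
  -- still below `c`; portmanteau applies to this fixed closed set.
  have hthick := (tendsto_measure_cthickening_of_isClosed (μ := (ν η₀ : Measure (Rd d)))
    (s := {y₀}) ⟨1, one_pos, measure_ne_top _ _⟩ isClosed_singleton).mono_left
      (nhdsWithin_le_nhds (s := Ioi 0))
  obtain ⟨r, hr, hr0⟩ := ((hthick.eventually (gt_mem_nhds hlt)).and self_mem_nhdsWithin).exists
  rw [Metric.cthickening_singleton _ (le_of_lt hr0)] at hr
  have hev := eventually_lt_of_limsup_lt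
    ((ProbabilityMeasure.limsup_measure_closed_le_of_tendsto hνlim
      Metric.isClosed_closedBall).trans_lt hr)
  filter_upwards [hev, hy (Metric.closedBall_mem_nhds y₀ hr0)] with n h1 h2
  rw [← ENNReal.ofReal_lt_ofReal_iff hc0, hmult]
  exact (measure_mono (singleton_subset_iff.2 (mem_preimage.1 h2))).trans_lt h1

/-- The multiplicity is the measure of a section of the closed set of pairs (t, γ) with γ(t) = u(t).
-/
theorem measurable_mult (η : ProbabilityMeasure (Curves d a b)) (u : Curves d a b) :
    Measurable fun t => mult η t (u t) := by
  have hS : MeasurableSet {x : Icc a b × Curves d a b | x.2 x.1 = u x.1} :=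
    (isClosed_eq (by fun_prop) (by fun_prop)).measurableSet
  have h := measurable_measure_prodMk_left (ν := (η : Measure (Curves d a b))) hS
  refine Measurable.subtype_mk ?_
  convert h.ennreal_toReal using 2 with t
  rw [← ENNReal.coe_toReal, ProbabilityMeasure.ennreal_coeFn_eq_coeFn_toMeasure,
    ProbabilityMeasure.toMeasure_map, Measure.map_apply
      (ContinuousEvalConst.continuous_eval_const t).measurable (measurableSet_singleton _)]
  rfl

end Multiplicity

/-! ### Lower semicontinuity of K. -/

section FunctionalK

variable {d : ℕ} {a b : ℝ}
  {f : Icc a b → ProbabilityMeasure (Curves d a b) → Rd d → Rd d → unitInterval → ℝ≥0∞}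

/-- With `η` frozen, f is composed with a continuous embedding of a product of second countable
spaces, whose Borel and product σ-algebras agree. -/
theorem measurable_integrand
    (hf_borel : IsBorelFun
      (fun p : Icc a b × ProbabilityMeasure (Curves d a b) × Rd d × Rd d × unitInterval =>
        f p.1 p.2.1 p.2.2.1 p.2.2.2.1 p.2.2.2.2))
    (η : ProbabilityMeasure (Curves d a b)) (u : Curves d a b) {w : Icc a b → Rd d}
    (hw : Measurable w) :
    Measurable fun t => f t η (u t) (w t) (mult η t (u t)) := by
  have hcont : Continuous fun x : Icc a b × Rd d × Rd d × unitInterval => (x.1, η, x.2) := by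
    fun_prop
  have hm := @Continuous.measurable _ _ _ _ _ _ (borel _) (@BorelSpace.mk _ _ (borel _) rfl) _ hcont
  have hg : Measurable fun x : Icc a b × Rd d × Rd d × unitInterval =>
      f x.1 η x.2.1 x.2.2.1 x.2.2.2 := @Measurable.comp _ _ _ _ (borel _) _ _ _ hf_borel hm
  exact hg.comp (measurable_id.prodMk
    (u.continuous.measurable.prodMk (hw.prodMk (measurable_mult η u))))

/-- Pointwise lower limits of the integrand: the multiplicity is upper semicontinuous and the
integrand is non-increasing in it. -/
theorem integrand_le_liminf {g : ProbabilityMeasure (Curves d a b) → Rd d → Rd d → unitInterval →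
      ℝ≥0∞}
    (hg : SeqLSC (fun p : ProbabilityMeasure (Curves d a b) × Rd d × Rd d × unitInterval =>
        g p.1 p.2.1 p.2.2.1 p.2.2.2))
    (hg_anti : ∀ η y z, Antitone (g η y z)) (t : Icc a b)
    {η : ℕ → ProbabilityMeasure (Curves d a b)} {η₀ : ProbabilityMeasure (Curves d a b)}
    (hη : Tendsto η atTop (𝓝 η₀)) {y z : ℕ → Rd d} {y₀ z₀ : Rd d}
    (hy : Tendsto y atTop (𝓝 y₀)) (hz : Tendsto z atTop (𝓝 z₀)) :
    g η₀ y₀ z₀ (mult η₀ t y₀) ≤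
      liminf (fun n => g (η n) (y n) (z n) (mult (η n) t (y n))) atTop := by
  refine le_liminf_of_forall_subseq_le fun c φ hφ hc => ?_
  -- The multiplicities need not converge to that of the limit, but by compactness they accumulate
  -- at some `s`, which is at most the limiting multiplicity. Semicontinuity is used at `s`, and
  -- monotonicity then passes to the larger value.
  obtain ⟨s, -, ψ, hψ, hs⟩ := (isCompact_univ (X := unitInterval)).tendsto_subseq
    (x := fun n => mult (η (φ n)) t (y (φ n))) fun _ => mem_univ _
  have hsub : Tendsto (φ ∘ ψ) atTop atTop := hφ.tendsto_atTop.comp hψ.tendsto_atTop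
  have hsle : s ≤ mult η₀ t y₀ := by
    refine Subtype.coe_le_coe.1 (le_of_forall_gt_imp_ge_of_dense fun r hr => ?_)
    refine le_of_tendsto ((continuous_subtype_val.tendsto _).comp hs) ?_
    filter_upwards [eventually_mult_lt (hη.comp hsub) t (hy.comp hsub) hr] with n hn using hn.le
  have hl := hg _ (η₀, y₀, z₀, s)
    ((hη.comp hsub).prodMk_nhds ((hy.comp hsub).prodMk_nhds ((hz.comp hsub).prodMk_nhds hs)))
  refine (hg_anti _ _ _ hsle).trans (hl.trans ?_)
  refine (liminf_le_liminf (v := fun _ => c) (Eventually.of_forall fun n => ?_)).trans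
    (liminf_const c).le
  exact hc (ψ n)

/-- Testing `v` against functionals serves both parts: weak convergence in (i), norm convergence of
the derivatives in (ii). -/
theorem functionalK_le_liminf
    (hf_borel : IsBorelFun
      (fun p : Icc a b × ProbabilityMeasure (Curves d a b) × Rd d × Rd d × unitInterval =>
        f p.1 p.2.1 p.2.2.1 p.2.2.2.1 p.2.2.2.2))
    (hf_lsc : ∀ᵐ t ∂(lebesgue a b),
      SeqLSC (fun p : ProbabilityMeasure (Curves d a b) × Rd d × Rd d × unitInterval =>
        f t p.1 p.2.1 p.2.2.1 p.2.2.2))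
    (hf_convex : ∀ t η y s, ConvexOn ℝ≥0 univ (fun z => f t η y z s))
    (hf_anti : ∀ t η y z, Antitone (fun s => f t η y z s))
    {q : ℝ≥0∞} [Fact (1 ≤ q)] {u : ℕ → Curves d a b} {u₀ : Curves d a b}
    (hu : Tendsto u atTop (𝓝 u₀)) {v : ℕ → Lp (Rd d) q (lebesgue a b)}
    {v₀ : Lp (Rd d) q (lebesgue a b)}
    (hv : ∀ l : StrongDual ℝ (Lp (Rd d) q (lebesgue a b)),
      Tendsto (fun n => l (v n)) atTop (𝓝 (l v₀)))
    {η : ℕ → ProbabilityMeasure (Curves d a b)} {η₀ : ProbabilityMeasure (Curves d a b)}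
    (hη : Tendsto η atTop (𝓝 η₀)) :
    functionalK f u₀ v₀ η₀ ≤ liminf (fun n => functionalK f (u n) (v n) (η n)) atTop := by
  refine le_liminf_of_forall_subseq_le fun c φ hφ hc => ?_
  have hφ' := hφ.tendsto_atTop
  have hpt : ∀ t, Tendsto (fun n => u n t) atTop (𝓝 (u₀ t)) := fun t =>
    ((ContinuousEvalConst.continuous_eval_const t).tendsto u₀).comp hu
  refine lintegral_le_of_tendsto_weak (v := fun n => v (φ n))
    (Fi := fun n t z => f t (η (φ n)) (u (φ n) t) z (mult (η (φ n)) t (u (φ n) t)))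
    (F := fun t z => f t η₀ (u₀ t) z (mult η₀ t (u₀ t)))
    (fun l => (hv l).comp hφ') (fun t => hf_convex _ _ _ _) ?_ ?_ (fun n => ?_) hc
  · filter_upwards [hf_lsc] with t ht x x₀ hx
    exact ht (fun n => (η₀, u₀ t, x n, mult η₀ t (u₀ t))) (η₀, u₀ t, x₀, mult η₀ t (u₀ t))
      (tendsto_const_nhds.prodMk_nhds (tendsto_const_nhds.prodMk_nhds
        (hx.prodMk_nhds tendsto_const_nhds)))
  · filter_upwards [hf_lsc] with t ht n z z₀ hn hz
    exact integrand_le_liminf ht (hf_anti t) t (hη.comp (hφ'.comp hn))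
      ((hpt t).comp (hφ'.comp hn)) hz
  · exact (measurable_integrand hf_borel _ _ (Lp.stronglyMeasurable (v (φ n))).measurable).aemeasurable

end FunctionalK

/-! ### Portmanteau theorems for l.s.c. and for varying integrands. -/

section Portmanteau

theorem lowerSemicontinuous_liminf_nhds {Ω : Type*} [TopologicalSpace Ω] (h : Ω → ℝ≥0∞) :
    LowerSemicontinuous fun ω => liminf h (𝓝 ω) := by
  intro ω c hc
  obtain ⟨c', hc', hlt⟩ := exists_between hc
  have hev : ∀ᶠ ω' in 𝓝 ω, c' < h ω' := eventually_lt_of_lt_liminf hlt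
  filter_upwards [eventually_eventually_nhds.2 hev] with ω' hω'
  exact hc'.trans_le (le_liminf_of_le (by isBoundedDefault) (hω'.mono fun _ h => h.le))

variable {Ω : Type*} [TopologicalSpace Ω] [MeasurableSpace Ω]

/-- Portmanteau theorem for l.s.c. functions with values in `[0, ∞]`. -/
theorem LowerSemicontinuous.lintegral_le_liminf [OpensMeasurableSpace Ω] [HasOuterApproxClosed Ω]
    {G : Ω → ℝ≥0∞}
    (hG : LowerSemicontinuous G) {μ : ℕ → ProbabilityMeasure Ω} {μ₀ : ProbabilityMeasure Ω}
    (hμ : Tendsto μ atTop (𝓝 μ₀)) :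
    ∫⁻ ω, G ω ∂(μ₀ : Measure Ω) ≤ liminf (fun n => ∫⁻ ω, G ω ∂(μ n : Measure Ω)) atTop := by
  have hopen : ∀ c, IsOpen {ω | c < G ω} := fun c => hG.isOpen_preimage c
  have hGm : Measurable G := measurable_of_Ioi fun c => (hopen c).measurableSet
  have hsup : ∀ ω, G ω = ⨆ N : ℕ, min (G ω) N := by
    intro ω
    rw [← inf_iSup_eq, ENNReal.iSup_natCast, inf_top_eq]
  -- Truncation makes the function real-valued, so that the layer-cake formula reduces the claim to
  -- open superlevel sets and Fatou in the level.
  have htrunc : ∀ N : ℕ, ∫⁻ ω, min (G ω) N ∂(μ₀ : Measure Ω) ≤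
      liminf (fun n => ∫⁻ ω, G ω ∂(μ n : Measure Ω)) atTop := by
    intro N
    set g : Ω → ℝ := fun ω => (min (G ω) N).toReal with hg
    have hfin : ∀ ω, min (G ω) (N : ℝ≥0∞) ≠ ∞ := fun ω =>
      ((min_le_right _ _).trans_lt (ENNReal.natCast_lt_top N)).ne
    have hgm : Measurable g := (hGm.min measurable_const).ennreal_toReal
    have hlayer : ∀ ν : Measure Ω, ∫⁻ ω, min (G ω) N ∂ν = ∫⁻ t in Ioi 0, ν {ω | t < g ω} := by
      intro ν
      rw [← lintegral_eq_lintegral_meas_lt ν (Eventually.of_forall fun ω => ENNReal.toReal_nonneg)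
        hgm.aemeasurable]
      exact lintegral_congr fun ω => (ENNReal.ofReal_toReal (hfin ω)).symm
    have hgo : ∀ t ∈ Ioi (0 : ℝ), IsOpen {ω | t < g ω} := by
      intro t ht
      have : {ω | t < g ω} = {ω | ENNReal.ofReal t < G ω} ∩ {ω | ENNReal.ofReal t < N} := by
        ext ω
        rw [mem_ofPred_eq, hg, ← ENNReal.ofReal_lt_iff_lt_toReal (le_of_lt ht) (hfin ω), lt_min_iff]
        rfl
      rw [this]
      exact (hopen _).inter isOpen_const
    rw [hlayer]
    calc ∫⁻ t in Ioi 0, (μ₀ : Measure Ω) {ω | t < g ω}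
        ≤ ∫⁻ t in Ioi 0, liminf (fun n => (μ n : Measure Ω) {ω | t < g ω}) atTop :=
          setLIntegral_mono' measurableSet_Ioi fun t ht =>
            ProbabilityMeasure.le_liminf_measure_open_of_tendsto hμ (hgo t ht)
      _ ≤ liminf (fun n => ∫⁻ t in Ioi 0, (μ n : Measure Ω) {ω | t < g ω}) atTop :=
          lintegral_liminf_le fun n =>
            Antitone.measurable fun s t hst => measure_mono fun ω hω => lt_of_le_of_lt hst hω
      _ ≤ _ := by
          refine liminf_le_liminf (Eventually.of_forall fun n => ?_)
          rw [← hlayer]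
          exact lintegral_mono fun ω => min_le_left _ _
  calc ∫⁻ ω, G ω ∂(μ₀ : Measure Ω) = ∫⁻ ω, ⨆ N : ℕ, min (G ω) N ∂(μ₀ : Measure Ω) :=
        lintegral_congr hsup
    _ = ⨆ N : ℕ, ∫⁻ ω, min (G ω) N ∂(μ₀ : Measure Ω) :=
        lintegral_iSup (fun N => hGm.min measurable_const) fun M N h ω =>
          min_le_min_left _ (by exact_mod_cast h)
    _ ≤ _ := iSup_le htrunc

/-- Lower semicontinuity of integrals when both the measures and the integrands vary. -/
theorem lintegral_le_liminf_lintegral_of_le_liminf [TopologicalSpace.PseudoMetrizableSpace Ω]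
    [BorelSpace Ω] {F : Ω → ℝ≥0∞} {Fn : ℕ → Ω → ℝ≥0∞}
    (h : ∀ (n : ℕ → ℕ) (ω : ℕ → Ω) (ω₀ : Ω), Tendsto n atTop atTop → Tendsto ω atTop (𝓝 ω₀) →
      F ω₀ ≤ liminf (fun j => Fn (n j) (ω j)) atTop)
    {μ : ℕ → ProbabilityMeasure Ω} {μ₀ : ProbabilityMeasure Ω} (hμ : Tendsto μ atTop (𝓝 μ₀)) :
    ∫⁻ ω, F ω ∂(μ₀ : Measure Ω) ≤ liminf (fun n => ∫⁻ ω, Fn n ω ∂(μ n : Measure Ω)) atTop := by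
  -- `G m` is the l.s.c. envelope of the tail infimum. It is measurable even if the `Fn` are not,
  -- and increases with `m`.
  let H : ℕ → Ω → ℝ≥0∞ := fun m ω => ⨅ n ≥ m, Fn n ω
  let G : ℕ → Ω → ℝ≥0∞ := fun m ω => liminf (H m) (𝓝 ω)
  have hHmono : ∀ m m', m ≤ m' → ∀ ω, H m ω ≤ H m' ω := fun m m' hm ω =>
    biInf_mono fun n hn => hm.trans hn
  have hGlsc : ∀ m, LowerSemicontinuous (G m) := fun m => lowerSemicontinuous_liminf_nhds _
  have hGmono : Monotone G := fun m m' hm ω =>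
    liminf_le_liminf (Eventually.of_forall fun ω' => hHmono m m' hm ω')
  have hGH : ∀ m ω, G m ω ≤ H m ω := fun m ω => le_of_forall_lt fun c hc =>
    (eventually_lt_of_lt_liminf hc).self_of_nhds
  -- If this failed, a countable neighbourhood basis would give indices `n m ≥ m` and points
  -- converging to `ω` with values of `Fn` below some `c < F ω`.
  have hFG : ∀ ω, F ω ≤ ⨆ m, G m ω := by
    intro ω
    by_contra! hlt
    obtain ⟨c, hc1, hc2⟩ := exists_between hlt
    obtain ⟨U, hU⟩ := (𝓝 ω).exists_antitone_basis
    have hex : ∀ m : ℕ, ∃ n ≥ m, ∃ ω' ∈ U m, Fn n ω' < c := by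
      intro m
      have hm : G m ω < c := (le_iSup (fun m => G m ω) m).trans_lt hc1
      obtain ⟨ω', h1, h2⟩ := ((frequently_lt_of_liminf_lt (by isBoundedDefault) hm).and_eventually
        (hU.mem m)).exists
      obtain ⟨n, hn, h3⟩ := by simpa only [H, iInf_lt_iff, exists_prop] using h1
      exact ⟨n, hn, ω', h2, h3⟩
    choose n hn ω' hω' hlt' using hex
    refine hc2.not_ge ((h n ω' ω (tendsto_atTop_mono hn tendsto_id) (hU.tendsto hω')).trans ?_)
    exact (liminf_le_liminf (v := fun _ => c) (Eventually.of_forall fun j => (hlt' j).le)).trans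
      (liminf_const c).le
  calc ∫⁻ ω, F ω ∂(μ₀ : Measure Ω) ≤ ∫⁻ ω, ⨆ m, G m ω ∂(μ₀ : Measure Ω) := lintegral_mono hFG
    _ = ⨆ m, ∫⁻ ω, G m ω ∂(μ₀ : Measure Ω) :=
        lintegral_iSup (fun m => (hGlsc m).measurable) hGmono
    _ ≤ _ := by
        refine iSup_le fun m => ((hGlsc m).lintegral_le_liminf hμ).trans ?_
        refine liminf_le_liminf ?_
        filter_upwards [eventually_ge_atTop m] with n hn
        exact lintegral_mono fun ω => (hGH m ω).trans (iInf₂_le n hn)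

end Portmanteau

/-! ### Sobolev curves and the conclusion. -/

namespace W1q

variable {d : ℕ} {a b : ℝ} {hab : a ≤ b} {q : ℝ≥0∞} [Fact (1 ≤ q)]

theorem isInducing_toCurve_derivLp :
    IsInducing (fun γ : W1q d hab q => (γ.toCurve, γ.derivLp)) := ⟨rfl⟩

instance instPseudoMetrizableSpace : TopologicalSpace.PseudoMetrizableSpace (W1q d hab q) :=
  isInducing_toCurve_derivLp.pseudoMetrizableSpace

theorem functionalJ_eq_lintegral_functionalK
    (f : Icc a b → ProbabilityMeasure (Curves d a b) → Rd d → Rd d → unitInterval → ℝ≥0∞)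
    (η : ProbabilityMeasure (W1q d hab q)) :
    functionalJ f η = ∫⁻ γ : W1q d hab q, functionalK f γ.toCurve γ.derivLp (pushCurves η)
      ∂(η : Measure (W1q d hab q)) := by
  refine lintegral_congr fun γ => lintegral_congr_ae ?_
  filter_upwards [γ.2.2.coeFn_toLp] with t ht
  rw [derivLp, ht]
  rfl

end W1q

theorem mainTheorem2 {d : ℕ} {a b : ℝ} (hab : a ≤ b)
    (f : Icc a b → ProbabilityMeasure (Curves d a b) → Rd d → Rd d → unitInterval → ℝ≥0∞)
    (hf_borel : IsBorelFun
      (fun p : Icc a b × ProbabilityMeasure (Curves d a b) × Rd d × Rd d × unitInterval =>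
        f p.1 p.2.1 p.2.2.1 p.2.2.2.1 p.2.2.2.2))
    (hf_lsc : ∀ᵐ t ∂(lebesgue a b),
      SeqLSC (fun p : ProbabilityMeasure (Curves d a b) × Rd d × Rd d × unitInterval =>
        f t p.1 p.2.1 p.2.2.1 p.2.2.2))
    (hf_convex : ∀ t η y s, ConvexOn ℝ≥0 univ (fun z => f t η y z s))
    (hf_anti : ∀ t η y z, Antitone (fun s => f t η y z s))
    (q : ℝ≥0∞) [Fact (1 ≤ q)] (hq : q ≠ ∞) :
    SeqLSC (fun p : Curves d a b ×
        WeakSpace ℝ (Lp (Rd d) q (lebesgue a b)) ×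
        ProbabilityMeasure (Curves d a b) =>
      functionalK f p.1 ((toWeakSpace ℝ (Lp (Rd d) q (lebesgue a b))).symm p.2.1)
        p.2.2) ∧
    SeqLSC (fun η : ProbabilityMeasure (W1q d hab q) => functionalJ f η) := by
  constructor
  · intro x x₀ hx
    have hu : Tendsto (fun n => (x n).1) atTop (𝓝 x₀.1) := (continuous_fst.tendsto _).comp hx
    have h2 : Tendsto (fun n => (x n).2) atTop (𝓝 x₀.2) := (continuous_snd.tendsto _).comp hx
    have hv : Tendsto (fun n => (x n).2.1) atTop (𝓝 x₀.2.1) := (continuous_fst.tendsto _).comp h2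
    have hη : Tendsto (fun n => (x n).2.2) atTop (𝓝 x₀.2.2) := (continuous_snd.tendsto _).comp h2
    refine functionalK_le_liminf hf_borel hf_lsc hf_convex hf_anti hu
      (v := fun n => (toWeakSpace ℝ (Lp (Rd d) q (lebesgue a b))).symm (x n).2.1)
      (fun l => ?_) hη
    exact ((WeakBilin.eval_continuous
      (topDualPairing ℝ (Lp (Rd d) q (lebesgue a b))).flip l).tendsto _).comp hv
  · intro η η₀ hη
    simp only [W1q.functionalJ_eq_lintegral_functionalK]
    have hpush : Tendsto (fun n => W1q.pushCurves (η n)) atTop (𝓝 (W1q.pushCurves η₀)) :=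
      ProbabilityMeasure.tendsto_map_of_tendsto_of_continuous _ _ hη W1q.continuous_toCurve
    -- The curve and the measure inside the integrand vary together, with independent indices.
    have key : ∀ (n : ℕ → ℕ) (γ : ℕ → W1q d hab q) (γ₀ : W1q d hab q), Tendsto n atTop atTop →
        Tendsto γ atTop (𝓝 γ₀) →
        functionalK f γ₀.toCurve γ₀.derivLp (W1q.pushCurves η₀) ≤ liminf (fun j =>
          functionalK f (γ j).toCurve (γ j).derivLp (W1q.pushCurves (η (n j)))) atTop := by
      intro n γ γ₀ hn hγ
      have hγ' := (W1q.isInducing_toCurve_derivLp.continuous.tendsto γ₀).comp hγ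
      have hu : Tendsto (fun j => (γ j).toCurve) atTop (𝓝 γ₀.toCurve) :=
        (continuous_fst.tendsto _).comp hγ'
      have hv : Tendsto (fun j => (γ j).derivLp) atTop (𝓝 γ₀.derivLp) :=
        (continuous_snd.tendsto _).comp hγ'
      exact functionalK_le_liminf hf_borel hf_lsc hf_convex hf_anti hu
        (fun l => (l.continuous.tendsto γ₀.derivLp).comp hv) (hpush.comp hn)
    exact lintegral_le_liminf_lintegral_of_le_liminf
      (F := fun γ : W1q d hab q => functionalK f γ.toCurve γ.derivLp (W1q.pushCurves η₀))
      (Fn := fun n γ => functionalK f γ.toCurve γ.derivLp (W1q.pushCurves (η n))) key hη
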